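/- Let $m\ge 1$ and consider a linear optical circuit on $4m$ bosonic modes $0,\dots,4m-1$ with transfer matrix $$U=(I_4\otimes F_m)\bigl((I_2\otimes F_2)\oplus(F_2\otimes I_{2(m-1)})\bigr),$$ where $I_d$ is the identity matrix, $F_d=\bigl(e^{2\pi i jk/d}/\sqrt d\bigr)_{0\le j,k<d}$ is the discrete Fourier matrix, and in $A\otimes B$ (with $A$ of size $a$) the mode $p+aq$ carries the index $p$ of $A$ and the index $q$ of $B$, i.e. the index of the first factor runs fastest. The circuit acts on creation operators by $a_i^\dagger\mapsto\sum_j a_j^\dagger U_{ji}$, so that its amplitude from the Fock state $|\mathbf n'\rangle$ to the Fock state $|\mathbf n\rangle$ is $\mathrm{Per}(U^{(\mathbf n,\mathbf n')})/\sqrt{\prod_i n_i!\,n'_i!}$, where $U^{(\mathbf n,\mathbf n')}$ is $U$ with its $i$-th row repeated $n_i$ times and its $j$-th column repeated $n'_j$ times. Two qubits are fed in by dual-rail encoding ($|0\rangle=|10\rangle$, $|1\rangle=|01\rangle$), the first into the modes $0,1$ and the second into the modes $2,3$; each of the other $4(m-1)$ modes receives one ancillary photon; and the photon numbers of all $4m$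 output modes are detected. Then $U$ is unitary, and the circuit realizes the two-qubit measurement with the Kraus operators $$\langle\psi^+|,\quad \langle\psi^-|,\quad \sqrt{1-m^{-1}}\,\langle\phi^+|,\quad K_k=\sqrt{\binom mk}\,\frac1{2^{m/2}}\Bigl[\langle\phi^-|+\frac{m-2k}{m}\langle\phi^+|\Bigr]\quad(k=0,\dots,m),$$ where $|\psi^\pm\rangle=(|01\rangle\pm|10\rangle)/\sqrt2$ and $|\phi^\pm\rangle=(|00\rangle\pm|11\rangle)/\sqrt2$. That is, writing $K_l$ for any operator of this list, $\sum_l K_l^\dagger K_l=I$; and to every detection pattern $\mathbf n$ of $4(m-1)+2$ photons one can assign a result $l=f(\mathbf n)$ such that the Kraus operator $A_{\mathbf n}$ of the pattern (the amplitude of $\mathbf n$ as a linear functional of the two-qubit input) is a scalar multiple of $K_{f(\mathbf n)}$, and for every result $l$ and every operator $\rho$ on the two qubits $$\sum_{\mathbf n:\,f(\mathbf n)=l}A_{\mathbf n}\,\rho\,A_{\mathbf n}^\dagger=K_l\,\rho\,K_l^\dagger .$$ -/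

import Mathlib

open scoped Matrix

noncomputable section

namespace LinearOptics

/-! ### Linear optical circuits on Fock states -/

/-- The amplitude `⟨n| B(S) |n'⟩` between Fock states with occupation numbers `n` (output) and `n'`
(input), for the linear optical circuit with transfer matrix `S` (`a_i† = ∑ j, a_j† S j i`):
`Per (S^(n,n')) / √(∏ i, n i ! * n' i !)`.  Here `S^(n,n')` is `S` with row `i` repeated `n i` times
and column `j` repeated `n' j` times; its rows and columns are indexed by `Σ i, Fin (n i)` and
`Σ j, Fin (n' j)`, so the permanent is the sum over the bijections from columns to rows.  (If the
photon numbers differ there is no bijection, and the amplitude is `0`.) -/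
def fockAmplitude {M : ℕ} (S : Matrix (Fin M) (Fin M) ℂ) (n n' : Fin M → ℕ) : ℂ :=
  (∑ e : (Σ j, Fin (n' j)) ≃ (Σ i, Fin (n i)), ∏ x, S (e x).1 x.1) /
    ((Real.sqrt (∏ i, ((n i).factorial * (n' i).factorial : ℝ)) : ℝ) : ℂ)

/-! ### The transfer matrix -/

/-- The discrete Fourier matrix `F_d`. -/
def fourier (d : ℕ) : Matrix (Fin d) (Fin d) ℂ :=
  Matrix.of fun j k =>
    Complex.exp (2 * Real.pi * Complex.I * (j : ℕ) * (k : ℕ) / d) / ((Real.sqrt d : ℝ) : ℂ)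

/-- The tensor product `A ⊗ B` of an `a × a` and a `b × b` transfer matrix, as a matrix on the
modes `0, …, a b - 1`.  Mode `p + a q` is the pair `(p, q)`: the index of the first factor runs
fastest, so `I_2 ⊗ F_2` mixes mode `0` with mode `2`, and mode `1` with mode `3`. -/
def tensor {a b : ℕ} (A : Matrix (Fin a) (Fin a) ℂ) (B : Matrix (Fin b) (Fin b) ℂ) :
    Matrix (Fin (b * a)) (Fin (b * a)) ℂ :=
  Matrix.of fun i j => A i.modNat j.modNat * B i.divNat j.divNat

/-- The direct sum `A ⊕ B`: `A` acts on the first `a` modes, `B` on the last `b` modes. -/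
def directSum {a b : ℕ} (A : Matrix (Fin a) (Fin a) ℂ) (B : Matrix (Fin b) (Fin b) ℂ) :
    Matrix (Fin (a + b)) (Fin (a + b)) ℂ :=
  Matrix.reindex finSumFinEquiv finSumFinEquiv (Matrix.fromBlocks A 0 0 B)

theorem mode_count {m : ℕ} (hm : 0 < m) : 2 * 2 + 2 * (m - 1) * 2 = m * 4 := by omega

/-- The transfer matrix `(I_4 ⊗ F_m) ((I_2 ⊗ F_2) ⊕ (F_2 ⊗ I_{2(m-1)}))` on `4 m` modes. -/
def bellTransfer (m : ℕ) (hm : 0 < m) : Matrix (Fin (m * 4)) (Fin (m * 4)) ℂ :=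
  tensor (1 : Matrix (Fin 4) (Fin 4) ℂ) (fourier m) *
    Matrix.reindex (finCongr (mode_count hm)) (finCongr (mode_count hm))
      (directSum (tensor (1 : Matrix (Fin 2) (Fin 2) ℂ) (fourier 2))
        (tensor (fourier 2) (1 : Matrix (Fin (2 * (m - 1))) (Fin (2 * (m - 1))) ℂ)))

/-! ### Dual-rail inputs and the Kraus operators of the detection patterns -/

/-- Labels of the computational basis of two qubits. -/
abbrev TwoQubit : Type := Fin 2 × Fin 2

/-- The Fock input for the two-qubit basis state `b`: the first qubit is dual-rail encoded in the
modes `0, 1`, the second one in the modes `2, 3` (`|0⟩ = |10⟩`, `|1⟩ = |01⟩`), and each of the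
remaining `4 (m - 1)` modes carries one ancillary photon. -/
def inputFock (m : ℕ) (b : TwoQubit) : Fin (m * 4) → ℕ := fun i =>
  if (i : ℕ) < 2 then (if (i : ℕ) = b.1 then 1 else 0)
  else if (i : ℕ) < 4 then (if (i : ℕ) = 2 + b.2 then 1 else 0)
  else 1

/-- The detection patterns on the `4 m` detectors: all distributions of the
`4 (m - 1) + 2` photons over the `4 m` modes. -/
def patterns (m : ℕ) : Finset (Fin (m * 4) → ℕ) :=
  Finset.piAntidiag Finset.univ (4 * (m - 1) + 2)

/-- The Kraus operator (a bra, as a one-row matrix) on the two input qubits that belongs to the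
detection pattern `n`: `|b⟩ ↦ ⟨n| B(U) |input b⟩`. -/
def detectorKraus (m : ℕ) (hm : 0 < m) (n : Fin (m * 4) → ℕ) : Matrix Unit TwoQubit ℂ :=
  Matrix.of fun _ b => fockAmplitude (bellTransfer m hm) n (inputFock m b)

/-! ### The two-qubit measurement -/

/-- The two-qubit basis ket `|i j⟩`. -/
def ket (i j : Fin 2) : TwoQubit → ℂ := Pi.single (i, j) 1

/-- `|ψ⁺⟩ = (|01⟩ + |10⟩) / √2` -/
def psiPlus : TwoQubit → ℂ := ((Real.sqrt 2 : ℝ) : ℂ)⁻¹ • (ket 0 1 + ket 1 0)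

/-- `|ψ⁻⟩ = (|01⟩ - |10⟩) / √2` -/
def psiMinus : TwoQubit → ℂ := ((Real.sqrt 2 : ℝ) : ℂ)⁻¹ • (ket 0 1 - ket 1 0)

/-- `|φ⁺⟩ = (|00⟩ + |11⟩) / √2` -/
def phiPlus : TwoQubit → ℂ := ((Real.sqrt 2 : ℝ) : ℂ)⁻¹ • (ket 0 0 + ket 1 1)

/-- `|φ⁻⟩ = (|00⟩ - |11⟩) / √2` -/
def phiMinus : TwoQubit → ℂ := ((Real.sqrt 2 : ℝ) : ℂ)⁻¹ • (ket 0 0 - ket 1 1)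

/-- The bra `⟨v|`, as a one-row matrix. -/
def bra (v : TwoQubit → ℂ) : Matrix Unit TwoQubit ℂ := Matrix.replicateRow Unit (star v)

/-- `K_k = √(C(m,k)) 2^(-m/2) (⟨φ⁻| + ((m - 2k)/m) ⟨φ⁺|)` -/
def krausK (m k : ℕ) : Matrix Unit TwoQubit ℂ :=
  ((Real.sqrt (m.choose k) * (2 : ℝ) ^ (-(m : ℝ) / 2) : ℝ) : ℂ) •
    (bra phiMinus + (((m : ℂ) - 2 * (k : ℂ)) / (m : ℂ)) • bra phiPlus)

/-- The family `⟨ψ⁺|, ⟨ψ⁻|, √(1 - 1/m) ⟨φ⁺|, K_0, …, K_m`. -/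
def bellKraus (m : ℕ) : Fin 3 ⊕ Fin (m + 1) → Matrix Unit TwoQubit ℂ :=
  Sum.elim
    ![bra psiPlus, bra psiMinus, ((Real.sqrt (1 - (m : ℝ)⁻¹) : ℝ) : ℂ) • bra phiPlus]
    (fun k => krausK m k)

/-! ### Correspondence of measurements -/

/-- `K` is the family of Kraus operators of a measurement (one operator for each result):
`∑ l, K_l† K_l = 1`. -/
def IsMeasurement {ι o q : Type*} [Fintype ι] [Fintype o] [Fintype q] [DecidableEq q]
    (K : ι → Matrix o q ℂ) : Prop :=
  ∑ l, (K l)ᴴ * K l = 1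

/-- The apparatus with outcomes `n ∈ S` and Kraus operators `A n` realizes the measurement with
Kraus operators `K l`: a rule `f` assigns a result to every outcome such that

* every outcome `n` acts, up to a scalar, by the Kraus operator of its result `f n`;
* for every result `l`, the quantum operation `ρ ↦ ∑ A_n ρ A_n†`, summed over the outcomes with
  result `l`, is `ρ ↦ K_l ρ K_l†`. -/
def Realizes {Ω ι o q : Type*} [DecidableEq ι] [Fintype o] [Fintype q]
    (S : Finset Ω) (A : Ω → Matrix o q ℂ) (K : ι → Matrix o q ℂ) : Prop :=
  ∃ f : Ω → ι,
    (∀ n ∈ S, ∃ c : ℂ, A n = c • K (f n)) ∧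
    ∀ l, ∀ ρ : Matrix q q ℂ, ∑ n ∈ S with f n = l, A n * ρ * (A n)ᴴ = K l * ρ * (K l)ᴴ

end LinearOptics

end

namespace MvPolynomial

variable {ι : Type*} [Fintype ι]

/-- The Bombieri (Fock space) form `∑ n, n! * conj (P_n) * Q_n`. -/
noncomputable def bombieri (P Q : MvPolynomial ι ℂ) : ℂ :=
  ∑ n ∈ P.support, (∏ i, ((n i).factorial : ℂ)) * (starRingEnd ℂ) (coeff n P) * coeff n Q

theorem bombieri_eq_sum_of_subset {P Q : MvPolynomial ι ℂ} {s : Finset (ι →₀ ℕ)}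
    (h : P.support ⊆ s) :
    bombieri P Q =
      ∑ n ∈ s, (∏ i, ((n i).factorial : ℂ)) * (starRingEnd ℂ) (coeff n P) * coeff n Q := by
  refine Finset.sum_subset h fun n _ hn => ?_
  rw [notMem_support_iff.mp hn]; simp

theorem bombieri_add_left (P P' Q : MvPolynomial ι ℂ) :
    bombieri (P + P') Q = bombieri P Q + bombieri P' Q := by
  classical
  rw [bombieri_eq_sum_of_subset (support_add (p := P) (q := P')),
    bombieri_eq_sum_of_subset (P := P) (Finset.subset_union_left (s₂ := P'.support)),
    bombieri_eq_sum_of_subset (P := P') (Finset.subset_union_right (s₁ := P.support)),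
    ← Finset.sum_add_distrib]
  refine Finset.sum_congr rfl fun n _ => ?_
  rw [coeff_add, map_add]; ring

theorem bombieri_C_mul_left (c : ℂ) (P Q : MvPolynomial ι ℂ) :
    bombieri (C c * P) Q = (starRingEnd ℂ) c * bombieri P Q := by
  rw [bombieri_eq_sum_of_subset (s := P.support), bombieri, Finset.mul_sum]
  · refine Finset.sum_congr rfl fun n _ => ?_
    rw [coeff_C_mul, map_mul]; ring
  · rw [← smul_eq_C_mul]; exact support_smul

theorem bombieri_add_right (P Q Q' : MvPolynomial ι ℂ) :
    bombieri P (Q + Q') = bombieri P Q + bombieri P Q' := by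
  simp only [bombieri, coeff_add, mul_add, Finset.sum_add_distrib]

theorem bombieri_C_mul_right (c : ℂ) (P Q : MvPolynomial ι ℂ) :
    bombieri P (C c * Q) = c * bombieri P Q := by
  simp only [bombieri, coeff_C_mul, Finset.mul_sum]
  exact Finset.sum_congr rfl fun n _ => by ring

@[simp] theorem bombieri_zero_left (Q : MvPolynomial ι ℂ) : bombieri 0 Q = 0 := by
  simp [bombieri]

@[simp] theorem bombieri_zero_right (Q : MvPolynomial ι ℂ) : bombieri Q 0 = 0 := by
  simp [bombieri]

theorem bombieri_sum_left {κ : Type*} (s : Finset κ) (P : κ → MvPolynomial ι ℂ)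
    (Q : MvPolynomial ι ℂ) : bombieri (∑ k ∈ s, P k) Q = ∑ k ∈ s, bombieri (P k) Q :=
  map_sum (AddMonoidHom.mk' (fun P => bombieri P Q) fun a b => bombieri_add_left a b Q) P s

theorem bombieri_sum_right {κ : Type*} (s : Finset κ) (P : κ → MvPolynomial ι ℂ)
    (Q : MvPolynomial ι ℂ) : bombieri Q (∑ k ∈ s, P k) = ∑ k ∈ s, bombieri Q (P k) :=
  map_sum (AddMonoidHom.mk' (fun P => bombieri Q P) fun a b => bombieri_add_right Q a b) P s

theorem bombieri_monomial_left (n : ι →₀ ℕ) (a : ℂ) (Q : MvPolynomial ι ℂ) :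
    bombieri (monomial n a) Q =
      (∏ i, ((n i).factorial : ℂ)) * (starRingEnd ℂ) a * coeff n Q := by
  classical
  rw [bombieri_eq_sum_of_subset (support_monomial_subset (s := n) (a := a)), Finset.sum_singleton,
    coeff_monomial, if_pos rfl]

theorem bombieri_X_mul_left (i : ι) (P Q : MvPolynomial ι ℂ) :
    bombieri (X i * P) Q = bombieri P (pderiv i Q) := by
  classical
  induction P using MvPolynomial.induction_on' with
  | monomial n a =>
    rw [X, monomial_mul, one_mul, bombieri_monomial_left, bombieri_monomial_left, coeff_pderiv,
      add_comm (Finsupp.single i 1) n]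
    have h : ∏ j, (((n + Finsupp.single i 1 : ι →₀ ℕ) j).factorial : ℂ) =
        (n i + 1) * ∏ j, ((n j).factorial : ℂ) := by
      rw [← Finset.mul_prod_erase _ _ (Finset.mem_univ i),
        ← Finset.mul_prod_erase _ (fun j => ((n j).factorial : ℂ)) (Finset.mem_univ i)]
      have : ∏ x ∈ Finset.univ.erase i, (((n + Finsupp.single i 1 : ι →₀ ℕ) x).factorial : ℂ) =
          ∏ x ∈ Finset.univ.erase i, ((n x).factorial : ℂ) := by
        refine Finset.prod_congr rfl fun x hx => ?_
        rw [Finsupp.add_apply, Finsupp.single_eq_of_ne (Finset.ne_of_mem_erase hx), add_zero]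
      rw [this, Finsupp.add_apply, Finsupp.single_eq_same, Nat.factorial_succ]
      push_cast; ring
    rw [h]; ring
  | add P P' hP hP' => rw [mul_add, bombieri_add_left, hP, hP', bombieri_add_left]

/-- The substitution `X j ↦ ∑ i, V i j X i`. -/
noncomputable def linSubst (V : Matrix ι ι ℂ) : MvPolynomial ι ℂ →ₐ[ℂ] MvPolynomial ι ℂ :=
  aeval fun j => ∑ i, C (V i j) * X i

@[simp] theorem linSubst_X (V : Matrix ι ι ℂ) (j : ι) :
    linSubst V (X j) = ∑ i, C (V i j) * X i := aeval_X _ _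

@[simp] theorem linSubst_C (V : Matrix ι ι ℂ) (c : ℂ) : linSubst V (C c) = C c :=
  algHom_C (linSubst V) c

theorem linSubst_mul (V W : Matrix ι ι ℂ) (P : MvPolynomial ι ℂ) :
    linSubst (V * W) P = linSubst V (linSubst W P) := by
  suffices h : linSubst (V * W) = (linSubst V).comp (linSubst W) by rw [h, AlgHom.comp_apply]
  refine algHom_ext fun j => ?_
  simp only [linSubst_X, AlgHom.comp_apply, map_sum, map_mul, linSubst_C, Matrix.mul_apply,
    Finset.sum_mul, Finset.mul_sum]
  rw [Finset.sum_comm]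
  exact Finset.sum_congr rfl fun k _ => Finset.sum_congr rfl fun i _ => by ring

theorem pderiv_linSubst [DecidableEq ι] (V : Matrix ι ι ℂ) (i : ι) (P : MvPolynomial ι ℂ) :
    pderiv i (linSubst V P) = ∑ k, C (V i k) * linSubst V (pderiv k P) := by
  induction P using MvPolynomial.induction_on with
  | C a => simp
  | add P Q hP hQ => simp only [map_add, hP, hQ, mul_add, Finset.sum_add_distrib]
  | mul_X P j hP =>
    have hX : pderiv i (linSubst V (X j)) = C (V i j) := by
      simp [pderiv_X, Pi.single_apply]
    have h1 : ∀ k, linSubst V (pderiv k (P * X j)) =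
        linSubst V (pderiv k P) * linSubst V (X j) + linSubst V P * (if k = j then 1 else 0) := by
      intro k
      rw [pderiv_mul, map_add, map_mul, map_mul, pderiv_X, Pi.single_apply]
      by_cases h : k = j
      · simp [h]
      · simp [h, Ne.symm h]
    simp only [h1]
    rw [map_mul, pderiv_mul, hP, hX]
    simp only [mul_add, Finset.sum_add_distrib, Finset.sum_mul, mul_ite, mul_one, mul_zero,
      Finset.sum_ite_eq', Finset.mem_univ, if_true]
    rw [mul_comm (C (V i j))]
    congr 1
    exact Finset.sum_congr rfl fun k _ => by ring

/-- Unitary substitutions preserve the Bombieri form. -/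
theorem bombieri_linSubst [DecidableEq ι] {V : Matrix ι ι ℂ} (hV : V ∈ Matrix.unitaryGroup ι ℂ)
    (P Q : MvPolynomial ι ℂ) : bombieri (linSubst V P) (linSubst V Q) = bombieri P Q := by
  induction P using MvPolynomial.induction_on generalizing Q with
  | C a =>
    rw [linSubst_C, C_apply, bombieri_monomial_left, bombieri_monomial_left]
    congr 1
    induction Q using MvPolynomial.induction_on with
    | C a => rw [linSubst_C]
    | add P Q hP hQ => rw [map_add, coeff_add, coeff_add, hP, hQ]
    | mul_X P j hP =>
      rw [map_mul, linSubst_X, ← constantCoeff_eq, ]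
      simp
  | add P P' hP hP' => rw [map_add, bombieri_add_left, hP, hP', bombieri_add_left]
  | mul_X P j hP =>
    rw [map_mul, mul_comm P, bombieri_X_mul_left, ← hP, linSubst_X, mul_comm, Finset.sum_mul,
      bombieri_sum_left]
    have h : ∀ i, bombieri (C (V i j) * X i * linSubst V P) (linSubst V Q) =
        ∑ k, (star (V i j) * V i k) * bombieri (linSubst V P) (linSubst V (pderiv k Q)) := by
      intro i
      rw [mul_assoc, bombieri_C_mul_left, bombieri_X_mul_left, pderiv_linSubst,
        bombieri_sum_right, Finset.mul_sum]
      refine Finset.sum_congr rfl fun k _ => ?_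
      rw [bombieri_C_mul_right, mul_assoc]; rfl
    simp only [h]
    rw [Finset.sum_comm]
    have h2 : ∀ k, ∑ i, star (V i j) * V i k = if j = k then 1 else 0 := by
      intro k
      have := congrFun (congrFun (Matrix.mem_unitaryGroup_iff'.mp hV) j) k
      rw [Matrix.one_apply] at this
      rw [← this, Matrix.mul_apply]; rfl
    simp only [← Finset.sum_mul, h2]
    simp

/-- The coefficients after rescaling the variables. -/
theorem coeff_aeval_C_mul_X (t : ι → ℂ) (n : ι →₀ ℕ) (P : MvPolynomial ι ℂ) :
    coeff n (aeval (fun i => C (t i) * X i) P) = (∏ i, t i ^ n i) * coeff n P := by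
  classical
  induction P using MvPolynomial.induction_on' with
  | monomial k a =>
    have : aeval (fun i => C (t i) * X i) (monomial k a) =
        C (∏ i, t i ^ k i) * monomial k a := by
      rw [aeval_monomial, Finsupp.prod_fintype _ _ (fun _ => pow_zero _)]
      simp only [mul_pow, Finset.prod_mul_distrib]
      rw [monomial_eq (s := k) (a := a), Finsupp.prod_fintype _ _ (fun _ => pow_zero _),
        algebraMap_eq, map_prod]
      simp only [map_pow]
      ring
    rw [this, coeff_C_mul, coeff_monomial]
    split_ifs with h
    · rw [h]
    · simp
  | add P Q hP hQ => rw [map_add, coeff_add, coeff_add, hP, hQ]; ring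

/-- The coefficients of the image under a diagonal Euler derivation. -/
theorem coeff_mkDerivation_C_mul_X (c : ι → ℂ) (n : ι →₀ ℕ) (P : MvPolynomial ι ℂ) :
    coeff n (mkDerivation ℂ (fun i => C (c i) * X i) P) = (∑ i, c i * n i) * coeff n P := by
  classical
  induction P using MvPolynomial.induction_on' with
  | monomial k a =>
    have : mkDerivation ℂ (fun i => C (c i) * X i) (monomial k a) =
        C (∑ i, c i * k i) * monomial k a := by
      rw [mkDerivation_monomial, Finsupp.sum_fintype _ _ (by simp), map_sum, Finset.sum_mul,
        Finset.smul_sum]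
      refine Finset.sum_congr rfl fun i _ => ?_
      have h := X_mul_pderiv_monomial (i := i) (m := k) (r := (1 : ℂ))
      rw [pderiv_monomial, one_mul, nsmul_eq_mul] at h
      rw [smul_eq_mul, mul_left_comm, mul_comm (monomial _ _) (X i), h, smul_eq_C_mul]
      have h' : monomial k a = C a * monomial k 1 := by rw [C_mul_monomial, mul_one]
      rw [h', map_mul, map_natCast]
      ring
    rw [this, coeff_C_mul, coeff_monomial]
    split_ifs with h
    · rw [h]
    · simp
  | add P Q hP hQ => rw [map_add, coeff_add, coeff_add, hP, hQ]; ring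

end MvPolynomial

namespace LinearOptics

open MvPolynomial

/-- A bijection onto a sigma type with prescribed first components is a family of bijections
between the fibres. -/
def equivSigmaOfFst {α ι : Type*} {β : ι → Type*} (g : α → ι) :
    {e : α ≃ Σ i, β i // ∀ x, (e x).1 = g x} ≃ (∀ i, {x // g x = i} ≃ β i) where
  toFun e i := (e.1.subtypeEquiv (q := fun y => y.1 = i) fun x => by rw [e.2 x]).trans
    (Equiv.sigmaSubtype i)
  invFun h := ⟨(Equiv.sigmaFiberEquiv g).symm.trans (Equiv.sigmaCongrRight h), fun _ => rfl⟩
  left_inv e := by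
    obtain ⟨e, he⟩ := e
    ext1
    ext1 x
    have key : ∀ (i : ι) (y : Σ i, β i) (h : y.1 = i),
        (⟨i, Equiv.sigmaSubtype i ⟨y, h⟩⟩ : Σ i, β i) = y := by
      rintro i y rfl; rfl
    exact key (g x) (e x) (he x)
  right_inv h := by
    funext i
    ext1 x
    obtain ⟨x, rfl⟩ := x
    rfl

theorem card_equivSigma_fst {α ι : Type*} [Fintype α] [Fintype ι] [DecidableEq α] [DecidableEq ι]
    (n : ι → ℕ) (g : α → ι) :
    Fintype.card {e : α ≃ Σ i, Fin (n i) // ∀ x, (e x).1 = g x} =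
      if ∀ i, Fintype.card {x // g x = i} = n i then ∏ i, (n i).factorial else 0 := by
  rw [Fintype.card_congr (equivSigmaOfFst g), Fintype.card_pi]
  split_ifs with h
  · refine Finset.prod_congr rfl fun i _ => ?_
    rw [Fintype.card_equiv (Fintype.equivFinOfCardEq (h i)), h i]
  · push Not at h
    obtain ⟨i, hi⟩ := h
    refine Finset.prod_eq_zero (Finset.mem_univ i) ?_
    rw [Fintype.card_eq_zero_iff]
    exact ⟨fun e => hi (by rw [Fintype.card_congr e, Fintype.card_fin])⟩

/-- The permanent in a Fock amplitude as a coefficient of a product of linear forms. -/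
theorem sum_equiv_prod_eq_coeff {ι : Type*} [Fintype ι] [DecidableEq ι] (S : Matrix ι ι ℂ)
    (n : ι →₀ ℕ) (n' : ι → ℕ) :
    ∑ e : (Σ j, Fin (n' j)) ≃ (Σ i, Fin (n i)), ∏ x, S (e x).1 x.1 =
      (∏ i, ((n i).factorial : ℂ)) * coeff n (∏ j, (linSubst S (X j)) ^ n' j) := by
  have hprod : ∏ j, (linSubst S (X j)) ^ n' j =
      ∑ g : (Σ j, Fin (n' j)) → ι, monomial (∑ x, Finsupp.single (g x) 1)
        (∏ x, S (g x) x.1) := by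
    have h1 : ∏ j, (linSubst S (X j)) ^ n' j =
        ∏ x : Σ j, Fin (n' j), ∑ i, monomial (Finsupp.single i 1) (S i x.1) := by
      rw [Fintype.prod_sigma]
      refine Finset.prod_congr rfl fun j _ => ?_
      rw [linSubst_X]
      simp only [X, C_mul_monomial, mul_one]
      exact (Fin.prod_const (n' j) _).symm
    rw [h1, Finset.prod_univ_sum, Fintype.piFinset_univ]
    refine Finset.sum_congr rfl fun g _ => ?_
    exact (monomial_sum_prod _ _ _).symm
  have hocc : ∀ g : (Σ j, Fin (n' j)) → ι,
      (∑ x, Finsupp.single (g x) 1 = n) ↔ ∀ i, Fintype.card {x // g x = i} = n i := by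
    intro g
    rw [Finsupp.ext_iff]
    refine forall_congr' fun i => ?_
    rw [Finsupp.finsetSum_apply, Fintype.card_subtype, Finset.card_filter]
    simp only [Finsupp.single_apply]
  rw [hprod, coeff_sum, Finset.mul_sum,
    ← Finset.sum_fiberwise Finset.univ (fun e : (Σ j, Fin (n' j)) ≃ (Σ i, Fin (n i)) =>
      fun x => (e x).1)]
  refine Finset.sum_congr rfl fun g _ => ?_
  have h2 : ∀ e ∈ Finset.univ.filter (fun e : (Σ j, Fin (n' j)) ≃ (Σ i, Fin (n i)) =>
      (fun x => (e x).1) = g), ∏ x, S (e x).1 x.1 = ∏ x, S (g x) x.1 := by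
    intro e he
    rw [Finset.mem_filter] at he
    rw [← he.2]
  rw [Finset.sum_congr rfl h2, Finset.sum_const, nsmul_eq_mul, coeff_monomial]
  have h3 : (Finset.univ.filter (fun e : (Σ j, Fin (n' j)) ≃ (Σ i, Fin (n i)) =>
      (fun x => (e x).1) = g)).card = 
      if ∀ i, Fintype.card {x // g x = i} = n i then ∏ i, (n i).factorial else 0 := by
    rw [← card_equivSigma_fst, Fintype.card_subtype]
    simp only [_root_.funext_iff]
  rw [h3]
  simp only [hocc]
  split_ifs <;> simp

/-- The Fock amplitude as a normalized coefficient. -/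
theorem fockAmplitude_eq_coeff {M : ℕ} (S : Matrix (Fin M) (Fin M) ℂ) (n : Fin M →₀ ℕ)
    (n' : Fin M → ℕ) (hn' : ∀ i, n' i ≤ 1) :
    fockAmplitude S n n' = ((Real.sqrt (∏ i, ((n i).factorial : ℝ)) : ℝ) : ℂ) *
      coeff n (linSubst S (∏ j, X j ^ n' j)) := by
  have h1 : ∀ i, ((n' i).factorial : ℝ) = 1 := fun i => by
    have := hn' i
    interval_cases n' i <;> simp
  rw [fockAmplitude, sum_equiv_prod_eq_coeff, map_prod]
  simp only [h1, mul_one, map_pow]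
  have hpos : (0 : ℝ) < ∏ i, ((n i).factorial : ℝ) :=
    Finset.prod_pos fun i _ => by exact_mod_cast Nat.factorial_pos _
  have hs : ((Real.sqrt (∏ i, ((n i).factorial : ℝ)) : ℝ) : ℂ) ≠ 0 := by
    exact_mod_cast (Real.sqrt_pos.mpr hpos).ne'
  rw [div_eq_iff hs]
  have : (∏ i, ((n i).factorial : ℂ)) = ((Real.sqrt (∏ i, ((n i).factorial : ℝ)) : ℝ) : ℂ) *
      ((Real.sqrt (∏ i, ((n i).factorial : ℝ)) : ℝ) : ℂ) := by
    rw [← Complex.ofReal_mul, Real.mul_self_sqrt hpos.le]; push_cast; rfl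
  rw [this]; ring

/-- The amplitude of the output pattern `n` in the (unnormalized) state described by the polynomial
`P`. -/
noncomputable def amp {M : ℕ} (P : MvPolynomial (Fin M) ℂ) (n : Fin M → ℕ) : ℂ :=
  ((Real.sqrt (∏ i, ((n i).factorial : ℝ)) : ℝ) : ℂ) * coeff (Finsupp.equivFunOnFinite.symm n) P

/-- The probabilities of the patterns with property `p` sum up to the norm of the component `Q` of
`P` that is supported on these patterns. -/
theorem sum_norm_sq_amp {M N : ℕ} (P Q : MvPolynomial (Fin M) ℂ) (p : (Fin M → ℕ) → Prop)
    [DecidablePred p] (hQ : ∀ n : Fin M →₀ ℕ, coeff n Q ≠ 0 → ∑ i, n i = N ∧ p n)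
    (hPQ : ∀ n : Fin M →₀ ℕ, p n → coeff n P = coeff n Q) :
    ((∑ n ∈ Finset.piAntidiag Finset.univ N with p n, ‖amp P n‖ ^ 2 : ℝ) : ℂ) =
      bombieri Q Q := by
  classical
  have hsub : Q.support ⊆ ((Finset.piAntidiag Finset.univ N).filter p).map
      (Finsupp.equivFunOnFinite (α := Fin M) (M := ℕ)).symm.toEmbedding := by
    intro n hn
    rw [Finset.mem_map_equiv, Finset.mem_filter, Finset.mem_piAntidiag]
    have := hQ n (mem_support_iff.mp hn)
    exact ⟨⟨this.1, fun i _ => Finset.mem_univ i⟩, this.2⟩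
  rw [bombieri_eq_sum_of_subset hsub, Finset.sum_map, Complex.ofReal_sum]
  refine Finset.sum_congr rfl fun n hn => ?_
  have hc := hPQ (Finsupp.equivFunOnFinite.symm n) (Finset.mem_filter.mp hn).2
  rw [amp, hc, norm_mul]
  have hpos : (0 : ℝ) ≤ ∏ i, ((n i).factorial : ℝ) :=
    Finset.prod_nonneg fun i _ => Nat.cast_nonneg _
  have : ‖((Real.sqrt (∏ i, ((n i).factorial : ℝ)) : ℝ) : ℂ)‖ ^ 2 =
      ∏ i, ((n i).factorial : ℝ) := by
    rw [Complex.norm_real, Real.norm_of_nonneg (Real.sqrt_nonneg _), Real.sq_sqrt hpos]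
  rw [mul_pow, this, Complex.ofReal_mul]
  refine Eq.trans ?_ (mul_assoc _ _ _).symm
  rw [Complex.conj_mul']
  push_cast
  rfl

end LinearOptics

theorem Derivation.map_prod_eq_sum {R A κ : Type*} [CommRing R] [CommRing A] [Algebra R A]
    [DecidableEq κ] (D : Derivation R A A) (s : Finset κ) (f : κ → A) :
    D (∏ i ∈ s, f i) = ∑ i ∈ s, D (f i) * ∏ j ∈ s.erase i, f j := by
  induction s using Finset.induction_on with
  | empty => simp
  | insert a s ha ih =>
    rw [Finset.prod_insert ha, D.leibniz, ih, Finset.sum_insert ha, Finset.erase_insert ha,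
      smul_eq_mul, smul_eq_mul, Finset.mul_sum, add_comm, mul_comm (∏ i ∈ s, f i)]
    congr 1
    refine Finset.sum_congr rfl fun i hi => ?_
    have hne : a ≠ i := fun h => ha (h ▸ hi)
    rw [Finset.erase_insert_of_ne hne, Finset.prod_insert (fun h => ha (Finset.mem_of_mem_erase h))]
    ring

namespace LinearOptics

open MvPolynomial

section Products

variable {m : ℕ} {R : Type*} [CommRing R] (y : Fin m → Fin 4 → R)

/-- `∏ q ∈ s, (y_{q,a}² - y_{q,b}²)` -/
def diffProd (s : Finset (Fin m)) (a b : Fin 4) : R := ∏ q ∈ s, (y q a ^ 2 - y q b ^ 2)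

/-- The product of all differences `y_{q,a}² - y_{q,b}²` with factor `r` replaced by the sum. -/
def markedProd (a b : Fin 4) (r : Fin m) : R :=
  (y r a ^ 2 + y r b ^ 2) * diffProd y (Finset.univ.erase r) a b

end Products

variable {m : ℕ}

/-- The mode with position `q` in group `p`, i.e. mode `p + 4 q`. -/
def mode (q : Fin m) (p : Fin 4) : Fin (m * 4) := finProdFinEquiv (q, p)

@[simp] theorem divNat_mode (q : Fin m) (p : Fin 4) : (mode q p).divNat = q :=
  congrArg Prod.fst (finProdFinEquiv.symm_apply_apply (q, p))

@[simp] theorem modNat_mode (q : Fin m) (p : Fin 4) : (mode q p).modNat = p :=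
  congrArg Prod.snd (finProdFinEquiv.symm_apply_apply (q, p))

@[simp] theorem mode_divNat_modNat (i : Fin (m * 4)) : mode i.divNat i.modNat = i :=
  finProdFinEquiv.apply_symm_apply i

theorem mode_val (q : Fin m) (p : Fin 4) : (mode q p : ℕ) = p + 4 * q := rfl

@[to_additive]
theorem prod_modes {A : Type*} [CommMonoid A] (f : Fin (m * 4) → A) :
    ∏ i, f i = ∏ q, ∏ p, f (mode q p) := by
  rw [← finProdFinEquiv.prod_comp, Fintype.prod_prod_type]; rfl

/-- The linear form `∑ j, F_{jq} X_{(j,p)}`. -/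
noncomputable def dftForm (q : Fin m) (p : Fin 4) : MvPolynomial (Fin (m * 4)) ℂ :=
  ∑ j, C (fourier m j q) * X (mode j p)

theorem linSubst_tensor_fourier (q : Fin m) (p : Fin 4) :
    linSubst (tensor (1 : Matrix (Fin 4) (Fin 4) ℂ) (fourier m)) (X (mode q p)) =
      dftForm q p := by
  have h : ∀ j p', tensor (1 : Matrix (Fin 4) (Fin 4) ℂ) (fourier m) (mode j p') (mode q p) =
      (1 : Matrix (Fin 4) (Fin 4) ℂ) p' p * fourier m j q := by
    intro j p'
    rw [tensor, Matrix.of_apply, modNat_mode, modNat_mode, divNat_mode, divNat_mode]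
  rw [linSubst_X, sum_modes, dftForm]
  refine Finset.sum_congr rfl fun j _ => ?_
  rw [Finset.sum_eq_single p]
  · rw [h, Matrix.one_apply_eq, one_mul]
  · intro p' _ hp'
    rw [h, Matrix.one_apply_ne hp', zero_mul, C_0, zero_mul]
  · simp

theorem fourier_apply_eq_pow (j k : Fin m) :
    fourier m j k =
      Complex.exp (2 * Real.pi * Complex.I / m) ^ ((j : ℕ) * k) / ((Real.sqrt m : ℝ) : ℂ) := by
  rw [fourier, Matrix.of_apply, ← Complex.exp_nat_mul]
  congr 2
  push_cast
  ring

theorem fourier_add_one [NeZero m] (j k : Fin m) :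
    fourier m j (k + 1) = Complex.exp (2 * Real.pi * Complex.I / m) ^ (j : ℕ) * fourier m j k := by
  have h1 : (Complex.exp (2 * Real.pi * Complex.I / m) ^ (j : ℕ)) ^ m = 1 := by
    rw [← pow_mul, mul_comm (j : ℕ) m, pow_mul, (Complex.isPrimitiveRoot_exp m (NeZero.ne m)).pow_eq_one,
      one_pow]
  rw [fourier_apply_eq_pow, fourier_apply_eq_pow, pow_mul, pow_mul, Fin.val_add, Fin.val_one',
    Nat.add_mod_mod, ← pow_eq_pow_mod _ h1]
  ring

/-- The occupation number of group `p`. -/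
def groupCount (n : Fin (m * 4) →₀ ℕ) (p : Fin 4) : ℕ := ∑ q, n (mode q p)

theorem aeval_phase_dftForm [NeZero m] (t : Fin m → Fin 4 → ℂ) (q : Fin m) (p : Fin 4) (k : Fin m)
    (ht : ∀ j, fourier m j k = t j p * fourier m j q) :
    aeval (fun i : Fin (m * 4) => C (t i.divNat i.modNat) * X i) (dftForm q p) = dftForm k p := by
  simp only [dftForm, map_sum, map_mul, algHom_C, aeval_X, divNat_mode, modNat_mode, ht,
    algebraMap_eq]
  exact Finset.sum_congr rfl fun j _ => by ring

theorem mkDerivation_dftForm (c : Fin 4 → ℂ) (q : Fin m) (p : Fin 4) :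
    mkDerivation ℂ (fun i : Fin (m * 4) => C (c i.modNat) * X i) (dftForm q p) =
      C (c p) * dftForm q p := by
  simp only [dftForm, map_sum, Derivation.leibniz, mkDerivation_X, derivation_C, modNat_mode,
    smul_eq_mul, Finset.mul_sum]
  exact Finset.sum_congr rfl fun j _ => by ring

theorem coeff_markedProd [NeZero m] {a b c d : Fin 4} (hab : a ≠ b) (hca : c ≠ a) (hcb : c ≠ b)
    (hda : d ≠ a) (hdb : d ≠ b) (n : Fin (m * 4) →₀ ℕ) (s : Finset (Fin m))
    (hn : coeff n (diffProd dftForm Finset.univ a b * diffProd dftForm s c d) ≠ 0) :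
    m * coeff n (markedProd dftForm a b 0 * diffProd dftForm s c d) =
      ((groupCount n a : ℂ) - groupCount n b) / 2 *
        coeff n (diffProd dftForm Finset.univ a b * diffProd dftForm s c d) := by
  set ω := Complex.exp (2 * Real.pi * Complex.I / m)
  let t : Fin m → Fin 4 → ℂ := fun j p => if p = a ∨ p = b then ω ^ (j : ℕ) else 1
  let τ : MvPolynomial (Fin (m * 4)) ℂ →ₐ[ℂ] MvPolynomial (Fin (m * 4)) ℂ :=
    aeval fun i : Fin (m * 4) => C (t i.divNat i.modNat) * X i
  have hτ1 : ∀ q, ∀ p, p = a ∨ p = b → τ (dftForm q p) = dftForm (q + 1) p := fun q p hp =>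
    aeval_phase_dftForm t q p (q + 1) fun j => by simp only [t, if_pos hp]; exact fourier_add_one j q
  have hτ2 : ∀ q, ∀ p, ¬ (p = a ∨ p = b) → τ (dftForm q p) = dftForm q p := fun q p hp =>
    aeval_phase_dftForm t q p q fun j => by simp only [t, if_neg hp, one_mul]
  have hτcd : τ (diffProd dftForm s c d) = diffProd dftForm s c d := by
    simp only [diffProd, map_prod, map_sub, map_pow]
    refine Finset.prod_congr rfl fun q _ => ?_
    rw [hτ2 q c (by tauto), hτ2 q d (by tauto)]
  have hτs : ∀ u : Finset (Fin m), τ (diffProd dftForm u a b) =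
      diffProd dftForm (u.map (Equiv.addRight (1 : Fin m)).toEmbedding) a b := by
    intro u
    simp only [diffProd, map_prod, map_sub, map_pow, Finset.prod_map]
    refine Finset.prod_congr rfl fun q _ => ?_
    rw [hτ1 q a (by tauto), hτ1 q b (by tauto)]
    rfl
  have hτG : τ (diffProd dftForm Finset.univ a b * diffProd dftForm s c d) =
      diffProd dftForm Finset.univ a b * diffProd dftForm s c d := by
    rw [map_mul, hτcd, hτs, Finset.map_univ_equiv]
  have hτr : ∀ r, τ (markedProd dftForm a b r * diffProd dftForm s c d) =
      markedProd dftForm a b (r + 1) * diffProd dftForm s c d := by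
    intro r
    rw [map_mul, hτcd, markedProd, map_mul, hτs, map_add, map_pow, map_pow, hτ1 r a (by tauto),
      hτ1 r b (by tauto), Finset.map_erase, Finset.map_univ_equiv]
    rfl
  have hphase : ∏ i : Fin (m * 4), t i.divNat i.modNat ^ n i = 1 := by
    have h := congrArg (coeff n) hτG
    rw [coeff_aeval_C_mul_X] at h
    exact mul_right_cancel₀ hn (h.trans (one_mul _).symm)
  have hstep : ∀ r, coeff n (markedProd dftForm a b (r + 1) * diffProd dftForm s c d) =
      coeff n (markedProd dftForm a b r * diffProd dftForm s c d) := by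
    intro r
    rw [← hτr, coeff_aeval_C_mul_X, hphase, one_mul]
  have hconst : ∀ r, coeff n (markedProd dftForm a b r * diffProd dftForm s c d) =
      coeff n (markedProd dftForm a b 0 * diffProd dftForm s c d) := by
    have : ∀ k : ℕ, coeff n (markedProd dftForm a b (Fin.ofNat m k) * diffProd dftForm s c d) =
        coeff n (markedProd dftForm a b 0 * diffProd dftForm s c d) := by
      intro k
      induction k with
      | zero => rfl
      | succ k ih =>
        have hk : Fin.ofNat m (k + 1) = Fin.ofNat m k + 1 := by
          ext
          simp [Fin.val_add]
        rw [hk, hstep, ih]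
    intro r
    rw [← this r]
    simp
  let e : Fin 4 → ℂ := fun p => if p = a then 1 / 2 else if p = b then - (1 / 2) else 0
  let D := mkDerivation ℂ (fun i : Fin (m * 4) => C (e i.modNat) * X i)
  have hD : ∀ q p, D (dftForm q p) = C (e p) * dftForm q p := mkDerivation_dftForm e
  have hsq : ∀ q p, D (dftForm q p ^ 2) = C (2 * e p) * dftForm q p ^ 2 := by
    intro q p
    rw [pow_two, D.leibniz, hD, smul_eq_mul, C_mul]
    simp only [map_ofNat]
    ring
  have hDcd : D (diffProd dftForm s c d) = 0 := by
    rw [diffProd, Derivation.map_prod_eq_sum]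
    refine Finset.sum_eq_zero fun q _ => ?_
    rw [map_sub, hsq, hsq]
    simp [e, hca, hcb, hda, hdb]
  have hDG : D (diffProd dftForm Finset.univ a b * diffProd dftForm s c d) =
      ∑ r, markedProd dftForm a b r * diffProd dftForm s c d := by
    have hu : D (diffProd dftForm Finset.univ a b) = ∑ r, markedProd dftForm a b r := by
      rw [diffProd, Derivation.map_prod_eq_sum]
      refine Finset.sum_congr rfl fun q _ => ?_
      rw [map_sub, hsq, hsq, markedProd, diffProd]
      simp [e, hab.symm]
    rw [D.leibniz, hDcd, smul_zero, zero_add, hu, smul_eq_mul,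
      mul_comm (diffProd _ _ _ _), Finset.sum_mul]
  have h := congrArg (coeff n) hDG
  rw [coeff_mkDerivation_C_mul_X, coeff_sum, Finset.sum_congr rfl fun r _ => hconst r,
    Finset.sum_const, Finset.card_univ, Fintype.card_fin, nsmul_eq_mul] at h
  rw [← h]
  congr 1
  rw [sum_modes, groupCount, groupCount, Finset.sum_comm]
  simp only [modNat_mode, ← Finset.mul_sum]
  have hp : ∀ p, e p * ∑ q : Fin m, (n (mode q p) : ℂ) =
      (if p = a then (1 / 2) * ∑ q : Fin m, (n (mode q a) : ℂ) else 0) +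
      (if p = b then - (1 / 2) * ∑ q : Fin m, (n (mode q b) : ℂ) else 0) := by
    intro p
    by_cases h1 : p = a
    · subst h1; simp [e, hab]
    · by_cases h2 : p = b
      · subst h2; simp [e, h1]
      · simp [e, h1, h2]
  simp only [hp, Finset.sum_add_distrib, Finset.sum_ite_eq', Finset.mem_univ, if_true]
  push_cast
  ring

end LinearOptics

namespace LinearOptics

open MvPolynomial

theorem fourier_mem_unitaryGroup {m : ℕ} [NeZero m] :
    fourier m ∈ Matrix.unitaryGroup (Fin m) ℂ := by
  rw [Matrix.mem_unitaryGroup_iff']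
  ext k l
  have hω := Complex.isPrimitiveRoot_exp m (NeZero.ne m)
  set ω := Complex.exp (2 * Real.pi * Complex.I / m) with hωdef
  have hconj : (starRingEnd ℂ) ω = ω⁻¹ := by
    rw [← Complex.inv_eq_conj (Complex.norm_eq_one_of_pow_eq_one hω.pow_eq_one (NeZero.ne m))]
  have hω0 : ω ≠ 0 := Complex.exp_ne_zero _
  have hm : ((Real.sqrt m : ℝ) : ℂ) * ((Real.sqrt m : ℝ) : ℂ) = m := by
    rw [← Complex.ofReal_mul, Real.mul_self_sqrt (Nat.cast_nonneg m), Complex.ofReal_natCast]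
  have hm0 : (m : ℂ) ≠ 0 := Nat.cast_ne_zero.mpr (NeZero.ne m)
  let z := (ω ^ (k : ℕ))⁻¹ * ω ^ (l : ℕ)
  have hterm : ∀ j : Fin m, star (fourier m) k j * fourier m j l = z ^ (j : ℕ) / m := by
    intro j
    rw [Matrix.star_apply, fourier_apply_eq_pow, fourier_apply_eq_pow, ← hωdef, Complex.star_def,
      map_div₀, map_pow, hconj, Complex.conj_ofReal, div_mul_div_comm, hm]
    congr 1
    simp only [z, mul_pow, inv_pow, ← pow_mul, mul_comm]
  rw [Matrix.mul_apply, Finset.sum_congr rfl fun j _ => hterm j, ← Finset.sum_div,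
    Fin.sum_univ_eq_sum_range (fun j => z ^ j)]
  by_cases hkl : k = l
  · subst hkl
    have hz : z = 1 := inv_mul_cancel₀ (pow_ne_zero _ hω0)
    simp [hz, hm0]
  · have hz : z ≠ 1 := by
      intro h
      have h' : ω ^ (l : ℕ) = ω ^ (k : ℕ) := by
        have := congrArg (ω ^ (k : ℕ) * ·) h
        simpa [z, mul_inv_cancel_left₀ (pow_ne_zero _ hω0)] using this
      exact hkl (Fin.ext (hω.pow_inj l.2 k.2 h').symm)
    have hzm : z ^ m = 1 := by
      simp only [z, mul_pow, inv_pow, ← pow_mul]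
      rw [mul_comm (k : ℕ), mul_comm (l : ℕ), pow_mul, pow_mul, hω.pow_eq_one]
      simp
    rw [Matrix.one_apply_ne hkl, div_eq_zero_iff]
    left
    have := geom_sum_mul z m
    rw [hzm, sub_self, mul_eq_zero] at this
    exact this.resolve_right (sub_ne_zero.mpr hz)

theorem submatrix_mem_unitaryGroup {α β : Type*} [Fintype α] [Fintype β] [DecidableEq α]
    [DecidableEq β] (e : α ≃ β) {A : Matrix β β ℂ} (hA : A ∈ Matrix.unitaryGroup β ℂ) :
    A.submatrix e e ∈ Matrix.unitaryGroup α ℂ := by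
  rw [Matrix.mem_unitaryGroup_iff'] at hA ⊢
  rw [Matrix.star_eq_conjTranspose, Matrix.conjTranspose_submatrix, Matrix.submatrix_mul_equiv,
    ← Matrix.star_eq_conjTranspose, hA, Matrix.submatrix_one_equiv]

theorem tensor_mem_unitaryGroup {a b : ℕ} {A : Matrix (Fin a) (Fin a) ℂ}
    {B : Matrix (Fin b) (Fin b) ℂ} (hA : A ∈ Matrix.unitaryGroup (Fin a) ℂ)
    (hB : B ∈ Matrix.unitaryGroup (Fin b) ℂ) :
    tensor A B ∈ Matrix.unitaryGroup (Fin (b * a)) ℂ := by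
  have : tensor A B =
      (Matrix.kroneckerMap (· * ·) B A).submatrix finProdFinEquiv.symm finProdFinEquiv.symm := by
    ext i j
    exact mul_comm _ _
  rw [this]
  exact submatrix_mem_unitaryGroup _ (Matrix.kronecker_mem_unitary hB hA)

theorem directSum_mem_unitaryGroup {a b : ℕ} {A : Matrix (Fin a) (Fin a) ℂ}
    {B : Matrix (Fin b) (Fin b) ℂ} (hA : A ∈ Matrix.unitaryGroup (Fin a) ℂ)
    (hB : B ∈ Matrix.unitaryGroup (Fin b) ℂ) :
    directSum A B ∈ Matrix.unitaryGroup (Fin (a + b)) ℂ := by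
  refine submatrix_mem_unitaryGroup (A := Matrix.fromBlocks A 0 0 B) finSumFinEquiv.symm ?_
  rw [Matrix.mem_unitaryGroup_iff'] at hA hB ⊢
  rw [Matrix.star_eq_conjTranspose] at hA hB ⊢
  rw [Matrix.fromBlocks_conjTranspose, Matrix.fromBlocks_multiply]
  simp [hA, hB]

/-- The first layer `(I_2 ⊗ F_2) ⊕ (F_2 ⊗ I_{2(m-1)})` of the circuit. -/
noncomputable def firstLayer (m : ℕ) (hm : 0 < m) : Matrix (Fin (m * 4)) (Fin (m * 4)) ℂ :=
  Matrix.reindex (finCongr (mode_count hm)) (finCongr (mode_count hm))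
    (directSum (tensor (1 : Matrix (Fin 2) (Fin 2) ℂ) (fourier 2))
      (tensor (fourier 2) (1 : Matrix (Fin (2 * (m - 1))) (Fin (2 * (m - 1))) ℂ)))

theorem secondLayer_mem_unitaryGroup (m : ℕ) [NeZero m] :
    tensor (1 : Matrix (Fin 4) (Fin 4) ℂ) (fourier m) ∈ Matrix.unitaryGroup (Fin (m * 4)) ℂ :=
  tensor_mem_unitaryGroup (one_mem _) fourier_mem_unitaryGroup

theorem firstLayer_mem_unitaryGroup (m : ℕ) (hm : 0 < m) :
    firstLayer m hm ∈ Matrix.unitaryGroup (Fin (m * 4)) ℂ :=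
  submatrix_mem_unitaryGroup _ (directSum_mem_unitaryGroup
    (tensor_mem_unitaryGroup (one_mem _) fourier_mem_unitaryGroup)
    (tensor_mem_unitaryGroup fourier_mem_unitaryGroup (one_mem _)))

theorem bellTransfer_mem_unitaryGroup (m : ℕ) (hm : 0 < m) :
    bellTransfer m hm ∈ Matrix.unitaryGroup (Fin (m * 4)) ℂ := by
  have : NeZero m := ⟨hm.ne'⟩
  exact mul_mem (secondLayer_mem_unitaryGroup m) (firstLayer_mem_unitaryGroup m hm)

theorem fourier_two_apply (j k : Fin 2) :
    fourier 2 j k = (if (j : ℕ) = 1 ∧ (k : ℕ) = 1 then -1 else 1) *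
      ((Real.sqrt 2 : ℝ) : ℂ)⁻¹ := by
  have h : Complex.exp (2 * Real.pi * Complex.I / (2 : ℕ)) = -1 := by
    rw [← Complex.exp_pi_mul_I]; congr 1; push_cast; ring
  rw [fourier_apply_eq_pow, h, div_eq_mul_inv]
  fin_cases j <;> fin_cases k <;> simp

theorem firstLayer_apply_of_lt {m : ℕ} (hm : 0 < m) {i j : Fin (m * 4)} (hj : (j : ℕ) < 4) :
    firstLayer m hm i j = if (i : ℕ) < 4 ∧ (i : ℕ) % 2 = j % 2 then
      (if (i : ℕ) / 2 = 1 ∧ (j : ℕ) / 2 = 1 then -1 else 1) * ((Real.sqrt 2 : ℝ) : ℂ)⁻¹ else 0 := by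
  have hj' : (finCongr (mode_count hm)).symm j =
      finSumFinEquiv (Sum.inl (⟨j, hj⟩ : Fin (2 * 2)) : Fin (2 * 2) ⊕ Fin (2 * (m - 1) * 2)) := by
    ext; simp
  rw [firstLayer, Matrix.reindex_apply, Matrix.submatrix_apply, hj', directSum,
    Matrix.reindex_apply, Matrix.submatrix_apply, Equiv.symm_apply_apply]
  by_cases hi : (i : ℕ) < 4
  · have hi' : (finCongr (mode_count hm)).symm i =
      finSumFinEquiv (Sum.inl (⟨i, hi⟩ : Fin (2 * 2)) : Fin (2 * 2) ⊕ Fin (2 * (m - 1) * 2)) := by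
      ext; simp
    rw [hi', Equiv.symm_apply_apply, Matrix.fromBlocks_apply₁₁, tensor, Matrix.of_apply,
      fourier_two_apply, Matrix.one_apply]
    simp only [Fin.ext_iff, Fin.coe_modNat, Fin.coe_divNat, hi, true_and]
    split_ifs <;> simp [*]
  · have h4 : (i : ℕ) - 4 < 2 * (m - 1) * 2 := by have := i.2; omega
    have hi' : (finCongr (mode_count hm)).symm i =
      finSumFinEquiv (Sum.inr (⟨i - 4, h4⟩ : Fin (2 * (m - 1) * 2)) :
        Fin (2 * 2) ⊕ Fin (2 * (m - 1) * 2)) := by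
      ext; simp; omega
    rw [hi', Equiv.symm_apply_apply, Matrix.fromBlocks_apply₂₁]
    simp [hi]

theorem firstLayer_apply_of_ge {m : ℕ} (hm : 0 < m) {i j : Fin (m * 4)} (hj : 4 ≤ (j : ℕ)) :
    firstLayer m hm i j = if (i : ℕ) / 2 = j / 2 then
      (if (i : ℕ) % 2 = 1 ∧ (j : ℕ) % 2 = 1 then -1 else 1) * ((Real.sqrt 2 : ℝ) : ℂ)⁻¹ else 0 := by
  have hj4 : (j : ℕ) - 4 < 2 * (m - 1) * 2 := by have := j.2; omega
  have hj' : (finCongr (mode_count hm)).symm j =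
      finSumFinEquiv (Sum.inr (⟨j - 4, hj4⟩ : Fin (2 * (m - 1) * 2)) :
        Fin (2 * 2) ⊕ Fin (2 * (m - 1) * 2)) := by
    ext; simp; omega
  rw [firstLayer, Matrix.reindex_apply, Matrix.submatrix_apply, hj', directSum,
    Matrix.reindex_apply, Matrix.submatrix_apply, Equiv.symm_apply_apply]
  by_cases hi : (i : ℕ) < 4
  · have hi' : (finCongr (mode_count hm)).symm i =
      finSumFinEquiv (Sum.inl (⟨i, hi⟩ : Fin (2 * 2)) : Fin (2 * 2) ⊕ Fin (2 * (m - 1) * 2)) := by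
      ext; simp
    rw [hi', Equiv.symm_apply_apply, Matrix.fromBlocks_apply₁₂, if_neg (by omega)]
    rfl
  · have h4 : (i : ℕ) - 4 < 2 * (m - 1) * 2 := by have := i.2; omega
    have hi' : (finCongr (mode_count hm)).symm i =
      finSumFinEquiv (Sum.inr (⟨i - 4, h4⟩ : Fin (2 * (m - 1) * 2)) :
        Fin (2 * 2) ⊕ Fin (2 * (m - 1) * 2)) := by
      ext; simp; omega
    have h1 : ((i : ℕ) - 4) / 2 = (j - 4) / 2 ↔ (i : ℕ) / 2 = j / 2 := by omega
    have h2 : ((i : ℕ) - 4) % 2 = (i : ℕ) % 2 := by omega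
    have h3 : ((j : ℕ) - 4) % 2 = (j : ℕ) % 2 := by omega
    rw [hi', Equiv.symm_apply_apply, Matrix.fromBlocks_apply₂₂, tensor, Matrix.of_apply,
      fourier_two_apply, Matrix.one_apply]
    simp only [Fin.ext_iff, Fin.coe_modNat, Fin.coe_divNat, h1, h2, h3]
    split_ifs <;> simp

theorem linSubst_X_eq_add {ι : Type*} [Fintype ι] (V : Matrix ι ι ℂ) {i i' j : ι}
    (hii' : i ≠ i') (h : ∀ l, l ≠ i → l ≠ i' → V l j = 0) :
    linSubst V (X j) = C (V i j) * X i + C (V i' j) * X i' := by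
  rw [linSubst_X]
  exact Finset.sum_eq_add i i' hii' (fun l _ hl => by rw [h l hl.1 hl.2, C_0, zero_mul])
    (by simp) (by simp)

theorem mode_ne {m : ℕ} {q : Fin m} {p p' : Fin 4} (h : p ≠ p') : mode q p ≠ mode q p' :=
  fun h' => h (by simpa using congrArg Fin.modNat h')

/-- Action of the first layer on a mode of the two qubits. -/
theorem linSubst_firstLayer_zero {m : ℕ} [NeZero m] (hm : 0 < m) :
    linSubst (firstLayer m hm) (X (mode 0 0)) =
        C ((Real.sqrt 2 : ℝ) : ℂ)⁻¹ * (X (mode 0 0) + X (mode 0 2)) ∧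
    linSubst (firstLayer m hm) (X (mode 0 1)) =
        C ((Real.sqrt 2 : ℝ) : ℂ)⁻¹ * (X (mode 0 1) + X (mode 0 3)) ∧
    linSubst (firstLayer m hm) (X (mode 0 2)) =
        C ((Real.sqrt 2 : ℝ) : ℂ)⁻¹ * (X (mode 0 0) - X (mode 0 2)) ∧
    linSubst (firstLayer m hm) (X (mode 0 3)) =
        C ((Real.sqrt 2 : ℝ) : ℂ)⁻¹ * (X (mode 0 1) - X (mode 0 3)) := by
  have hv : ∀ p : Fin 4, ((mode (0 : Fin m) p : Fin (m * 4)) : ℕ) = p := fun p => by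
    simp [mode_val]
  have hV : ∀ p p' : Fin 4, firstLayer m hm (mode 0 p') (mode 0 p) =
      if (p' : ℕ) % 2 = p % 2 then
      (if (p' : ℕ) / 2 = 1 ∧ (p : ℕ) / 2 = 1 then -1 else 1) * ((Real.sqrt 2 : ℝ) : ℂ)⁻¹ else 0 := by
    intro p p'
    rw [firstLayer_apply_of_lt hm (by rw [hv]; exact p.2), hv, hv]
    simp [p'.2]
  have hz : ∀ p p₁ p₂ : Fin 4, (∀ r : Fin 4, r ≠ p₁ → r ≠ p₂ → (r : ℕ) % 2 ≠ p % 2) →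
      ∀ l, l ≠ mode 0 p₁ → l ≠ mode 0 p₂ → firstLayer m hm l (mode 0 p) = 0 := by
    intro p p₁ p₂ h l h1 h2
    rw [firstLayer_apply_of_lt hm (by rw [hv]; exact p.2), hv, if_neg]
    rintro ⟨hl, hl'⟩
    have hl0 : l = mode 0 ⟨l, hl⟩ := by ext; rw [hv]
    exact h ⟨l, hl⟩ (fun e => h1 (e ▸ hl0)) (fun e => h2 (e ▸ hl0)) hl'
  refine ⟨?_, ?_, ?_, ?_⟩
  · rw [linSubst_X_eq_add _ (mode_ne (by decide)) (hz 0 0 2 (by decide)), hV, hV]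
    simp; ring
  · rw [linSubst_X_eq_add _ (mode_ne (by decide)) (hz 1 1 3 (by decide)), hV, hV]
    simp; ring
  · rw [linSubst_X_eq_add _ (mode_ne (by decide)) (hz 2 0 2 (by decide)), hV, hV]
    simp; ring
  · rw [linSubst_X_eq_add _ (mode_ne (by decide)) (hz 3 1 3 (by decide)), hV, hV]
    simp; ring

/-- Action of the first layer on an ancillary mode. -/
theorem linSubst_firstLayer_ancilla {m : ℕ} [NeZero m] (hm : 0 < m) {q : Fin m} (hq : q ≠ 0) :
    linSubst (firstLayer m hm) (X (mode q 0)) =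
        C ((Real.sqrt 2 : ℝ) : ℂ)⁻¹ * (X (mode q 0) + X (mode q 1)) ∧
    linSubst (firstLayer m hm) (X (mode q 1)) =
        C ((Real.sqrt 2 : ℝ) : ℂ)⁻¹ * (X (mode q 0) - X (mode q 1)) ∧
    linSubst (firstLayer m hm) (X (mode q 2)) =
        C ((Real.sqrt 2 : ℝ) : ℂ)⁻¹ * (X (mode q 2) + X (mode q 3)) ∧
    linSubst (firstLayer m hm) (X (mode q 3)) =
        C ((Real.sqrt 2 : ℝ) : ℂ)⁻¹ * (X (mode q 2) - X (mode q 3)) := by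
  have hq1 : 1 ≤ (q : ℕ) := Nat.one_le_iff_ne_zero.mpr fun h => hq (Fin.ext h)
  have h4 : ∀ p, 4 ≤ ((mode q p : Fin (m * 4)) : ℕ) := fun p => by rw [mode_val]; omega
  have hV : ∀ p p' : Fin 4, firstLayer m hm (mode q p') (mode q p) =
      if (p' : ℕ) / 2 = p / 2 then
      (if (p' : ℕ) % 2 = 1 ∧ (p : ℕ) % 2 = 1 then -1 else 1) * ((Real.sqrt 2 : ℝ) : ℂ)⁻¹ else 0 := by
    intro p p'
    rw [firstLayer_apply_of_ge hm (h4 p), mode_val, mode_val]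
    have h1 : ((p' : ℕ) + 4 * q) / 2 = (p + 4 * q) / 2 ↔ (p' : ℕ) / 2 = p / 2 := by omega
    have h2 : ∀ r : ℕ, (r + 4 * (q : ℕ)) % 2 = r % 2 := by omega
    simp only [h1, h2]
  have hz : ∀ p p₁ p₂ : Fin 4, (∀ r : Fin 4, r ≠ p₁ → r ≠ p₂ → (r : ℕ) / 2 ≠ p / 2) →
      ∀ l, l ≠ mode q p₁ → l ≠ mode q p₂ → firstLayer m hm l (mode q p) = 0 := by
    intro p p₁ p₂ h l h1 h2
    rw [firstLayer_apply_of_ge hm (h4 p), if_neg]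
    intro hl
    rw [mode_val] at hl
    have hl0 : l = mode q ⟨(l : ℕ) - 4 * q, by omega⟩ := by
      ext; rw [mode_val]; simp only []; omega
    refine h ⟨(l : ℕ) - 4 * q, by omega⟩ (fun e => h1 (e ▸ hl0)) (fun e => h2 (e ▸ hl0)) ?_
    simp only []; omega
  refine ⟨?_, ?_, ?_, ?_⟩
  · rw [linSubst_X_eq_add _ (mode_ne (by decide)) (hz 0 0 1 (by decide)), hV, hV]
    simp; ring
  · rw [linSubst_X_eq_add _ (mode_ne (by decide)) (hz 1 0 1 (by decide)), hV, hV]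
    simp; ring
  · rw [linSubst_X_eq_add _ (mode_ne (by decide)) (hz 2 2 3 (by decide)), hV, hV]
    simp; ring
  · rw [linSubst_X_eq_add _ (mode_ne (by decide)) (hz 3 2 3 (by decide)), hV, hV]
    simp; ring

end LinearOptics

namespace LinearOptics

open MvPolynomial

variable {m : ℕ}

section Products

variable {R : Type*} [CommRing R] (y : Fin m → Fin 4 → R)

theorem diffProd_univ [NeZero m] (a b : Fin 4) :
    diffProd y Finset.univ a b =
      (y 0 a ^ 2 - y 0 b ^ 2) * diffProd y (Finset.univ.erase 0) a b :=
  (Finset.mul_prod_erase _ _ (Finset.mem_univ 0)).symm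

theorem map_diffProd {S F : Type*} [CommRing S] [FunLike F R S] [RingHomClass F R S] (φ : F)
    (s : Finset (Fin m)) (a b : Fin 4) :
    φ (diffProd y s a b) = diffProd (fun q p => φ (y q p)) s a b := by
  simp only [diffProd, map_prod, map_sub, map_pow]

/-- The two-mode factor carrying the two-qubit basis state `b` behind the beam splitters. -/
def qubitFactor [NeZero m] (b : TwoQubit) : R :=
  (if b.1 = 0 then y 0 0 + y 0 2 else y 0 1 + y 0 3) *
    (if b.2 = 0 then y 0 0 - y 0 2 else y 0 1 - y 0 3)

/-- The factor carrying the ancillary photons behind the beam splitters. -/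
def ancillaFactor [NeZero m] : R :=
  diffProd y (Finset.univ.erase 0) 0 1 * diffProd y (Finset.univ.erase 0) 2 3

end Products

variable [NeZero m] (hm : 0 < m)

theorem inv_sqrt_two_mul_self : ((Real.sqrt 2 : ℝ) : ℂ)⁻¹ * ((Real.sqrt 2 : ℝ) : ℂ)⁻¹ = 1 / 2 := by
  rw [← mul_inv, ← Complex.ofReal_mul, Real.mul_self_sqrt (by norm_num)]
  norm_num

theorem linSubst_firstLayer_input (b : TwoQubit) :
    linSubst (firstLayer m hm) (∏ j, X j ^ inputFock m b j) =
      C ((1 / 2) ^ (2 * m - 1)) * (qubitFactor (fun q p => X (mode q p)) b *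
        ancillaFactor fun q p => X (mode q p)) := by
  set c : MvPolynomial (Fin (m * 4)) ℂ := C ((Real.sqrt 2 : ℝ) : ℂ)⁻¹ with hc
  have hcc : c * c = C (1 / 2) := by rw [hc, ← C_mul, inv_sqrt_two_mul_self]
  have hanc : ∀ q : Fin m, q ≠ 0 →
      ∏ p, linSubst (firstLayer m hm) (X (mode q p)) ^ inputFock m b (mode q p) =
      C (1 / 2) ^ 2 * ((X (mode q 0) ^ 2 - X (mode q 1) ^ 2) *
        (X (mode q 2) ^ 2 - X (mode q 3) ^ 2)) := by
    intro q hq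
    have hq1 : 1 ≤ (q : ℕ) := Nat.one_le_iff_ne_zero.mpr fun h => hq (Fin.ext h)
    have h1 : ∀ p, inputFock m b (mode q p) = 1 := fun p => by
      rw [inputFock, mode_val, if_neg (by omega), if_neg (by omega)]
    obtain ⟨h0, h2, h3, h4⟩ := linSubst_firstLayer_ancilla hm hq
    simp only [h1, pow_one, Fin.prod_univ_four]
    rw [h0, h2, h3, h4, ← hc, ← hcc]
    ring
  have hqub : ∏ p, linSubst (firstLayer m hm) (X (mode 0 p)) ^ inputFock m b (mode 0 p) =
      C (1 / 2) * qubitFactor (fun q p => X (mode q p)) b := by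
    obtain ⟨h0, h2, h3, h4⟩ := linSubst_firstLayer_zero (m := m) hm
    have hv : ∀ p : Fin 4, ((mode (0 : Fin m) p : Fin (m * 4)) : ℕ) = p := fun p => by
      simp [mode_val]
    simp only [Fin.prod_univ_four]
    rw [h0, h2, h3, h4, ← hc, ← hcc]
    obtain ⟨b1, b2⟩ := b
    fin_cases b1 <;> fin_cases b2 <;> simp [inputFock, hv, qubitFactor] <;> ring
  simp only [map_prod, map_pow]
  rw [prod_modes, ← Finset.mul_prod_erase _ _ (Finset.mem_univ (0 : Fin m)), hqub,
    Finset.prod_congr rfl fun q hq => hanc q (Finset.ne_of_mem_erase hq), Finset.prod_mul_distrib,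
    Finset.prod_mul_distrib, Finset.prod_const, Finset.card_erase_of_mem (Finset.mem_univ _),
    Finset.card_univ, Fintype.card_fin, ancillaFactor, diffProd, diffProd]
  have h : 2 * m - 1 = 1 + 2 * (m - 1) := by omega
  rw [h, pow_add, pow_one, pow_mul]
  ring

/-- The output state of the circuit for the two-qubit basis input `b`. -/
noncomputable def outBasis (b : TwoQubit) : MvPolynomial (Fin (m * 4)) ℂ :=
  linSubst (bellTransfer m hm) (∏ j, X j ^ inputFock m b j)

theorem outBasis_eq (b : TwoQubit) :
    outBasis hm b = C ((1 / 2) ^ (2 * m - 1)) * (qubitFactor dftForm b * ancillaFactor dftForm) := by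
  have h : linSubst (bellTransfer m hm) (∏ j, X j ^ inputFock m b j) =
      linSubst (tensor (1 : Matrix (Fin 4) (Fin 4) ℂ) (fourier m))
        (linSubst (firstLayer m hm) (∏ j, X j ^ inputFock m b j)) := linSubst_mul _ _ _
  rw [outBasis, h, linSubst_firstLayer_input]
  simp only [map_mul, linSubst_C, ancillaFactor, map_diffProd, linSubst_tensor_fourier,
    qubitFactor]
  split_ifs <;> simp only [map_add, map_sub, linSubst_tensor_fourier]

omit [NeZero m] in
theorem inputFock_le_one (b : TwoQubit) (i : Fin (m * 4)) : inputFock m b i ≤ 1 := by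
  unfold inputFock; split_ifs <;> simp

omit [NeZero m] in
theorem detectorKraus_apply (n : Fin (m * 4) → ℕ) (u : Unit) (b : TwoQubit) :
    detectorKraus m hm n u b = amp (outBasis hm b) n := by
  exact fockAmplitude_eq_coeff _ (Finsupp.equivFunOnFinite.symm n) _ (inputFock_le_one b)

theorem inputFock_injective : Function.Injective (inputFock m) := by
  intro b b' h
  have h4 : ∀ p : Fin 4, (p : ℕ) < m * 4 := fun p => by
    have := NeZero.pos m
    omega
  have h0 := congrFun h ⟨0, h4 0⟩
  have h2 := congrFun h ⟨2, h4 2⟩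
  obtain ⟨b1, b2⟩ := b
  obtain ⟨b1', b2'⟩ := b'
  revert h0 h2
  fin_cases b1 <;> fin_cases b2 <;> fin_cases b1' <;> fin_cases b2' <;> simp [inputFock]

theorem bombieri_outBasis (b b' : TwoQubit) :
    bombieri (outBasis hm b) (outBasis hm b') = if b = b' then 1 else 0 := by
  have hmono : ∀ b : TwoQubit, (∏ j, X j ^ inputFock m b j : MvPolynomial (Fin (m * 4)) ℂ) =
      monomial (Finsupp.equivFunOnFinite.symm (inputFock m b)) 1 := by
    intro b
    rw [monomial_eq, C_1, one_mul, Finsupp.prod_fintype _ _ fun _ => pow_zero _]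
    rfl
  rw [outBasis, outBasis, bombieri_linSubst (bellTransfer_mem_unitaryGroup m hm), hmono, hmono,
    bombieri_monomial_left, coeff_monomial]
  have hf : ∀ i, ((inputFock m b i).factorial : ℂ) = 1 := fun i => by
    have := inputFock_le_one b i
    interval_cases inputFock m b i <;> simp
  have hi : Finsupp.equivFunOnFinite.symm (inputFock m b') =
      Finsupp.equivFunOnFinite.symm (inputFock m b) ↔ b = b' := by
    rw [Equiv.apply_eq_iff_eq, inputFock_injective.eq_iff, eq_comm]
  simp only [hi, Finsupp.equivFunOnFinite_symm_apply_apply, hf]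
  simp

/-- The output state of the circuit for the two-qubit input `v`. -/
noncomputable def outState (v : TwoQubit → ℂ) : MvPolynomial (Fin (m * 4)) ℂ :=
  ∑ b, C (v b) * outBasis hm b

omit [NeZero m] in
theorem amp_outState (v : TwoQubit → ℂ) (n : Fin (m * 4) → ℕ) :
    amp (outState hm v) n = ∑ b, v b * amp (outBasis hm b) n := by
  simp only [amp, outState, coeff_sum, coeff_C_mul, Finset.mul_sum]
  exact Finset.sum_congr rfl fun b _ => by ring

theorem bombieri_outState (v w : TwoQubit → ℂ) :
    bombieri (outState hm v) (outState hm w) = ∑ b, (starRingEnd ℂ) (v b) * w b := by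
  simp only [outState, bombieri_sum_left, bombieri_sum_right, bombieri_C_mul_left,
    bombieri_C_mul_right, bombieri_outBasis]
  simp [mul_comm]

/-- The common normalization of the output states for Bell state inputs. -/
noncomputable def outNorm (m : ℕ) : ℂ := ((Real.sqrt 2 : ℝ) : ℂ)⁻¹ * (1 / 2) ^ (2 * m - 1)

theorem outState_psiPlus : outState hm psiPlus = C (2 * outNorm m) *
    ((dftForm 0 0 * dftForm 0 1 - dftForm 0 2 * dftForm 0 3) * ancillaFactor dftForm) := by
  simp [outState, psiPlus, ket, Fintype.sum_prod_type, outBasis_eq, qubitFactor, outNorm,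
    Pi.single_apply]
  rw [show (C 2 : MvPolynomial (Fin (m * 4)) ℂ) = 2 from map_ofNat C 2]
  ring

theorem outState_psiMinus : outState hm psiMinus = C (2 * outNorm m) *
    ((dftForm 0 1 * dftForm 0 2 - dftForm 0 0 * dftForm 0 3) * ancillaFactor dftForm) := by
  simp [outState, psiMinus, ket, Fintype.sum_prod_type, outBasis_eq, qubitFactor, outNorm,
    Pi.single_apply]
  rw [show (C 2 : MvPolynomial (Fin (m * 4)) ℂ) = 2 from map_ofNat C 2]
  ring

theorem outState_phiMinus : outState hm phiMinus = C (outNorm m) *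
    (diffProd dftForm Finset.univ 0 1 * diffProd dftForm (Finset.univ.erase 0) 2 3 -
      diffProd dftForm Finset.univ 2 3 * diffProd dftForm (Finset.univ.erase 0) 0 1) := by
  rw [diffProd_univ, diffProd_univ]
  simp [outState, phiMinus, ket, Fintype.sum_prod_type, outBasis_eq, qubitFactor, outNorm,
    Pi.single_apply, ancillaFactor]
  ring

theorem outState_phiPlus : outState hm phiPlus = C (outNorm m) *
    (markedProd dftForm 0 1 0 * diffProd dftForm (Finset.univ.erase 0) 2 3 -
      markedProd dftForm 2 3 0 * diffProd dftForm (Finset.univ.erase 0) 0 1) := by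
  simp [outState, phiPlus, ket, Fintype.sum_prod_type, outBasis_eq, qubitFactor, outNorm,
    Pi.single_apply, ancillaFactor, markedProd]
  ring

end LinearOptics

namespace LinearOptics

open MvPolynomial

variable {m : ℕ}

section Selection

variable {R : Type*} [CommRing R] (y : Fin m → Fin 4 → R)

/-- The term of the expansion of `diffProd y s a b` with the modes of group `b` at positions `T`. -/
def selProd (s T : Finset (Fin m)) (a b : Fin 4) : R := ∏ q ∈ s, y q (if q ∈ T then b else a) ^ 2

/-- The component of `diffProd y s a b` with `k` factors from group `b`. -/
def diffComponent (s : Finset (Fin m)) (a b : Fin 4) (k : ℕ) : R :=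
  ∑ T ∈ s.powersetCard k, (-1) ^ T.card * selProd y s T a b

theorem diffProd_eq_sum_powerset (s : Finset (Fin m)) (a b : Fin 4) :
    diffProd y s a b = ∑ T ∈ s.powerset, (-1) ^ T.card * selProd y s T a b := by
  have h : diffProd y s a b = ∏ q ∈ s, (-(y q b ^ 2) + y q a ^ 2) :=
    Finset.prod_congr rfl fun q _ => by ring
  rw [h, Finset.prod_add]
  refine Finset.sum_congr rfl fun T hT => ?_
  have hT' := Finset.mem_powerset.mp hT
  rw [Finset.prod_neg, selProd, ← Finset.prod_sdiff hT', mul_assoc, mul_comm (∏ q ∈ s \ T, _)]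
  congr 2
  · exact Finset.prod_congr rfl fun q hq => by rw [if_pos hq]
  · exact Finset.prod_congr rfl fun q hq => by rw [if_neg (Finset.mem_sdiff.mp hq).2]

theorem diffProd_eq_sum_diffComponent (s : Finset (Fin m)) (a b : Fin 4) :
    diffProd y s a b = ∑ k ∈ Finset.range (s.card + 1), diffComponent y s a b k := by
  rw [diffProd_eq_sum_powerset, Finset.sum_powerset]
  rfl

theorem map_diffComponent {S F : Type*} [CommRing S] [FunLike F R S] [RingHomClass F R S] (φ : F)
    (s : Finset (Fin m)) (a b : Fin 4) (k : ℕ) :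
    φ (diffComponent y s a b k) = diffComponent (fun q p => φ (y q p)) s a b k := by
  simp only [diffComponent, selProd, map_sum, map_mul, map_prod, map_pow, map_neg, map_one]

end Selection

section Weights

variable {M : Type*} [AddCommMonoid M] (ω : Fin 4 → M)

/-- The weight of a mode determined by its group. -/
def groupWeight (i : Fin (m * 4)) : M := ω i.modNat

theorem isWeightedHomogeneous_dftForm (q : Fin m) (p : Fin 4) :
    IsWeightedHomogeneous (groupWeight ω) (dftForm q p) (ω p) := by
  refine IsWeightedHomogeneous.sum _ _ _ fun j _ => IsWeightedHomogeneous.C_mul ?_ _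
  have h := isWeightedHomogeneous_X ℂ (groupWeight (m := m) ω) (mode j p)
  rwa [groupWeight, modNat_mode] at h

theorem isWeightedHomogeneous_diffProd (s : Finset (Fin m)) {a b : Fin 4}
    (h : 2 • ω b = 2 • ω a) :
    IsWeightedHomogeneous (groupWeight ω) (diffProd dftForm s a b) (s.card • 2 • ω a) := by
  rw [← Finset.sum_const]
  exact IsWeightedHomogeneous.prod _ _ _ fun q _ =>
    ((isWeightedHomogeneous_dftForm ω q a).pow 2).sub
      (h ▸ (isWeightedHomogeneous_dftForm ω q b).pow 2)

theorem isWeightedHomogeneous_markedProd {a b : Fin 4} (r : Fin m) (h : 2 • ω b = 2 • ω a) :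
    IsWeightedHomogeneous (groupWeight ω) (markedProd dftForm a b r) (m • 2 • ω a) := by
  have h1 := (((isWeightedHomogeneous_dftForm ω r a).pow 2).add
      (h ▸ (isWeightedHomogeneous_dftForm ω r b).pow 2)).mul
    (isWeightedHomogeneous_diffProd ω (Finset.univ.erase r) h)
  rw [Finset.card_erase_of_mem (Finset.mem_univ _), Finset.card_univ, Fintype.card_fin] at h1
  have h2 : 2 • ω a + (m - 1) • 2 • ω a = m • 2 • ω a := by
    rw [← succ_nsmul', Nat.sub_add_cancel r.pos]
  rw [h2] at h1
  exact h1

theorem isWeightedHomogeneous_diffComponent (s : Finset (Fin m)) (a b : Fin 4) (k : ℕ) :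
    IsWeightedHomogeneous (groupWeight ω) (diffComponent dftForm s a b k)
      (k • 2 • ω b + (s.card - k) • 2 • ω a) := by
  refine IsWeightedHomogeneous.sum _ _ _ fun T hT => ?_
  obtain ⟨hTs, hTk⟩ := Finset.mem_powersetCard.mp hT
  have h1 : IsWeightedHomogeneous (groupWeight ω) (selProd (R := MvPolynomial (Fin (m * 4)) ℂ)
      dftForm s T a b) (∑ q ∈ s, 2 • ω (if q ∈ T then b else a)) :=
    IsWeightedHomogeneous.prod _ _ _ fun q _ => (isWeightedHomogeneous_dftForm ω q _).pow 2
  have h2 : ∑ q ∈ s, 2 • ω (if q ∈ T then b else a) =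
      k • 2 • ω b + (s.card - k) • 2 • ω a := by
    rw [← Finset.sum_sdiff hTs, add_comm,
      Finset.sum_congr rfl fun q (hq : q ∈ T) => by rw [if_pos hq],
      Finset.sum_congr rfl fun q (hq : q ∈ s \ T) => by rw [if_neg (Finset.mem_sdiff.mp hq).2],
      Finset.sum_const, Finset.sum_const, Finset.card_sdiff_of_subset hTs, hTk]
  rw [h2] at h1
  have h3 : ((-1) ^ T.card : MvPolynomial (Fin (m * 4)) ℂ) = C ((-1) ^ T.card) := by simp
  rw [h3]
  exact h1.C_mul _

/-- The weight of a monomial in terms of the occupation numbers of the groups. -/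
theorem weight_groupWeight (n : Fin (m * 4) →₀ ℕ) :
    Finsupp.weight (groupWeight ω) n = ∑ p, groupCount n p • ω p := by
  rw [Finsupp.weight_apply, Finsupp.sum_fintype _ _ (by simp), sum_modes,
    Finset.sum_comm]
  refine Finset.sum_congr rfl fun p _ => ?_
  rw [groupCount, Finset.sum_smul]
  exact Finset.sum_congr rfl fun q _ => by rw [groupWeight, modNat_mode]

end Weights

section Expansion

variable {s s' T T' : Finset (Fin m)} {a b c d : Fin 4}

/-- The occupation numbers of a term of the expansion of `diffProd y s a b * diffProd y s' c d`. -/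
noncomputable def selOccupation (s s' T T' : Finset (Fin m)) (a b c d : Fin 4) :
    Fin (m * 4) →₀ ℕ :=
  (∑ q ∈ s, Finsupp.single (mode q (if q ∈ T then b else a)) 2) +
    ∑ q ∈ s', Finsupp.single (mode q (if q ∈ T' then d else c)) 2

theorem mode_inj {q q' : Fin m} {p p' : Fin 4} : mode q p = mode q' p' ↔ q = q' ∧ p = p' := by
  rw [mode, mode, finProdFinEquiv.apply_eq_iff_eq, Prod.mk.injEq]

theorem selOccupation_mode (q : Fin m) (p : Fin 4) :
    selOccupation s s' T T' a b c d (mode q p) =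
      (if q ∈ s ∧ p = (if q ∈ T then b else a) then 2 else 0) +
        if q ∈ s' ∧ p = (if q ∈ T' then d else c) then 2 else 0 := by
  have h : ∀ (u : Finset (Fin m)) (g : Fin m → Fin 4),
      (∑ q ∈ u, Finsupp.single (mode q (g q)) 2) (mode q p) =
        if q ∈ u ∧ p = g q then 2 else 0 := by
    intro u g
    rw [Finsupp.finsetSum_apply]
    simp only [Finsupp.single_apply, mode_inj]
    by_cases hq : q ∈ u
    · rw [Finset.sum_eq_single q (fun q' _ h => if_neg fun h' => h h'.1) (fun h => absurd hq h)]
      simp [hq, eq_comm]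
    · rw [if_neg fun h => hq h.1]
      exact Finset.sum_eq_zero fun q' hq' => if_neg (by rintro ⟨rfl, _⟩; exact hq hq')
  rw [selOccupation, Finsupp.add_apply, h, h]

theorem selProd_mul_selProd_X : selProd (fun q p => (X (mode q p) : MvPolynomial _ ℂ)) s T a b *
    selProd (fun q p => X (mode q p)) s' T' c d =
      monomial (selOccupation s s' T T' a b c d) 1 := by
  have h : ∀ (u V : Finset (Fin m)) (p p' : Fin 4),
      selProd (fun q p => (X (mode q p) : MvPolynomial _ ℂ)) u V p p' =
      monomial (∑ q ∈ u, Finsupp.single (mode q (if q ∈ V then p' else p)) 2) 1 := by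
    intro u V p p'
    rw [monomial_sum_one]
    exact Finset.prod_congr rfl fun q _ => by rw [X_pow_eq_monomial]
  rw [h, h, monomial_mul, one_mul, selOccupation]

theorem prod_factorial_selOccupation (hac : a ≠ c) (had : a ≠ d) (hbc : b ≠ c) (hbd : b ≠ d) :
    ∏ i, ((selOccupation s s' T T' a b c d i).factorial : ℂ) = 2 ^ (s.card + s'.card) := by
  have hq : ∀ q, ∏ p, ((selOccupation s s' T T' a b c d (mode q p)).factorial : ℂ) =
      (if q ∈ s then 2 else 1) * if q ∈ s' then 2 else 1 := by
    intro q
    have h : ∀ p, ((selOccupation s s' T T' a b c d (mode q p)).factorial : ℂ) =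
        (if p = (if q ∈ T then b else a) then (if q ∈ s then 2 else 1) else 1) *
        (if p = (if q ∈ T' then d else c) then (if q ∈ s' then 2 else 1) else 1) := by
      intro p
      have hne : (if q ∈ T then b else a) ≠ if q ∈ T' then d else c := by split_ifs <;> assumption
      rw [selOccupation_mode]
      by_cases h1 : p = (if q ∈ T then b else a)
      · by_cases h3 : q ∈ s <;> simp [h3, h1, hne]
      · by_cases h2 : p = (if q ∈ T' then d else c)
        · by_cases h3 : q ∈ s' <;> simp [h3, h2, hne.symm]
        · simp [h1, h2]
    rw [Finset.prod_congr rfl fun p _ => h p, Finset.prod_mul_distrib, Finset.prod_ite_eq',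
      Finset.prod_ite_eq', if_pos (Finset.mem_univ _), if_pos (Finset.mem_univ _)]
  rw [prod_modes, Finset.prod_congr rfl fun q _ => hq q, Finset.prod_mul_distrib, pow_add]
  congr 1 <;> simp

theorem selOccupation_inj {U U' : Finset (Fin m)} (hab : a ≠ b) (hbc : b ≠ c) (hbd : b ≠ d)
    (had : a ≠ d) (hcd : c ≠ d) (hT : T ⊆ s) (hT' : T' ⊆ s') (hU : U ⊆ s) (hU' : U' ⊆ s')
    (h : selOccupation s s' T T' a b c d = selOccupation s s' U U' a b c d) :
    T = U ∧ T' = U' := by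
  have h1 : ∀ (V V' : Finset (Fin m)), V ⊆ s → V' ⊆ s' → ∀ q,
      (q ∈ V ↔ selOccupation s s' V V' a b c d (mode q b) ≠ 0) ∧
      (q ∈ V' ↔ selOccupation s s' V V' a b c d (mode q d) ≠ 0) := by
    intro V V' hV hV' q
    rw [selOccupation_mode, selOccupation_mode]
    constructor
    · by_cases hq : q ∈ V
      · simp [hq, hV hq]
      · by_cases hq' : q ∈ V' <;> simp [hq, hq', hab.symm, hbc, hbd]
    · by_cases hq : q ∈ V'
      · simp [hq, hV' hq]
      · by_cases hq' : q ∈ V <;> simp [hq, hq', had.symm, hcd.symm, hbd.symm]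
  constructor
  · ext q
    rw [(h1 T T' hT hT' q).1, (h1 U U' hU hU' q).1, h]
  · ext q
    rw [(h1 T T' hT hT' q).2, (h1 U U' hU hU' q).2, h]

theorem bombieri_sum_sign_monomial {ι κ : Type*} [Fintype ι] (I : Finset κ) (ε : κ → ℕ)
    (E : κ → ι →₀ ℕ) (hE : Set.InjOn E I) {N : ℂ} (hN : ∀ t ∈ I, ∏ i, ((E t i).factorial : ℂ) = N) :
    bombieri (∑ t ∈ I, (-1) ^ ε t * monomial (E t) 1) (∑ t ∈ I, (-1) ^ ε t * monomial (E t) 1) =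
      I.card * N := by
  classical
  have hsign : ∀ k : ℕ, ((-1) ^ k : MvPolynomial ι ℂ) = C ((-1) ^ k) := fun k => by simp
  rw [bombieri_sum_left, ← nsmul_eq_mul, ← Finset.sum_const]
  refine Finset.sum_congr rfl fun t ht => ?_
  rw [bombieri_sum_right, Finset.sum_eq_single t]
  · rw [hsign, bombieri_C_mul_left, bombieri_C_mul_right, bombieri_monomial_left, coeff_monomial,
      if_pos rfl, hN t ht, ← mul_assoc, map_pow, ← mul_pow]
    simp
  · intro t' ht' hne
    rw [hsign, hsign, bombieri_C_mul_left, bombieri_C_mul_right, bombieri_monomial_left,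
      coeff_monomial, if_neg fun h => hne (hE ht' ht h)]
    simp
  · exact fun h => absurd ht h

theorem bombieri_diffComponent [NeZero m] (hab : a ≠ b) (hac : a ≠ c) (had : a ≠ d) (hbc : b ≠ c)
    (hbd : b ≠ d) (hcd : c ≠ d) (s s' : Finset (Fin m)) (k : ℕ) :
    bombieri (diffComponent dftForm s a b k * diffProd dftForm s' c d)
        (diffComponent dftForm s a b k * diffProd dftForm s' c d) =
      (s.card.choose k * 2 ^ s'.card) * 2 ^ (s.card + s'.card) := by
  have hV : diffComponent dftForm s a b k * diffProd dftForm s' c d =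
      linSubst (tensor (1 : Matrix (Fin 4) (Fin 4) ℂ) (fourier m))
        (diffComponent (fun q p => X (mode q p)) s a b k *
          diffProd (fun q p => X (mode q p)) s' c d) := by
    rw [map_mul, map_diffComponent, map_diffProd]
    simp only [linSubst_tensor_fourier]
  have hexp : diffComponent (fun q p => (X (mode q p) : MvPolynomial (Fin (m * 4)) ℂ)) s a b k *
      diffProd (fun q p => X (mode q p)) s' c d =
      ∑ t ∈ s.powersetCard k ×ˢ s'.powerset, (-1) ^ (t.1.card + t.2.card) *
        monomial (selOccupation s s' t.1 t.2 a b c d) 1 := by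
    rw [diffProd_eq_sum_powerset, diffComponent, Finset.sum_mul_sum, ← Finset.sum_product']
    refine Finset.sum_congr rfl fun t _ => ?_
    rw [← selProd_mul_selProd_X, pow_add]
    ring
  rw [hV, bombieri_linSubst (secondLayer_mem_unitaryGroup m), hexp]
  refine (bombieri_sum_sign_monomial (s.powersetCard k ×ˢ s'.powerset)
    (fun t => t.1.card + t.2.card) (fun t => selOccupation s s' t.1 t.2 a b c d) ?_
    fun t _ => prod_factorial_selOccupation hac had hbc hbd).trans ?_
  · intro t ht u hu h
    rw [Finset.mem_coe, Finset.mem_product, Finset.mem_powersetCard, Finset.mem_powerset] at ht hu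
    obtain ⟨h1, h2⟩ := selOccupation_inj hab hbc hbd had hcd ht.1.1 ht.2 hu.1.1 hu.2 h
    exact Prod.ext h1 h2
  · rw [Finset.card_product, Finset.card_powersetCard, Finset.card_powerset]
    push_cast
    rfl

end Expansion

end LinearOptics

namespace LinearOptics

open MvPolynomial

variable {m : ℕ}

theorem sum_eq_sum_groupCount (n : Fin (m * 4) →₀ ℕ) : ∑ i, n i = ∑ p, groupCount n p := by
  rw [sum_modes, Finset.sum_comm]; rfl

theorem card_erase_univ [NeZero m] : (Finset.univ.erase (0 : Fin m)).card = m - 1 := by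
  rw [Finset.card_erase_of_mem (Finset.mem_univ _), Finset.card_univ, Fintype.card_fin]

section Support

variable {a b c d : Fin 4} {n : Fin (m * 4) →₀ ℕ}

theorem groupCount_of_coeff_diffComponent_ne_zero [NeZero m] (hab : a ≠ b) (hac : a ≠ c)
    (had : a ≠ d) (hbc : b ≠ c) (hbd : b ≠ d) (hcd : c ≠ d) {k : ℕ}
    (h : coeff n (diffComponent dftForm Finset.univ a b k *
      diffProd dftForm (Finset.univ.erase 0) c d) ≠ 0) :
    groupCount n a = 2 * (m - k) ∧ groupCount n b = 2 * k ∧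
      groupCount n c + groupCount n d = 2 * (m - 1) := by
  have key : ∀ ω : Fin 4 → ℕ, ω d = ω c → ∑ p, groupCount n p • ω p =
      k • 2 • ω b + (m - k) • 2 • ω a + (m - 1) • 2 • ω c := by
    intro ω hω
    have h1 := (isWeightedHomogeneous_diffComponent ω Finset.univ a b k).mul
      (isWeightedHomogeneous_diffProd ω (Finset.univ.erase (0 : Fin m)) (a := c) (b := d)
        (by rw [hω]))
    rw [card_erase_univ, Finset.card_univ, Fintype.card_fin] at h1
    rw [← weight_groupWeight]
    exact h1 h
  have ha := key (Pi.single a 1) (by simp [hac.symm, had.symm])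
  have hb := key (Pi.single b 1) (by simp [hbc.symm, hbd.symm])
  have hc := key (Pi.single c 1 + Pi.single d 1) (by simp [hcd, hcd.symm])
  simp [Pi.single_apply, hab, hab.symm, hac.symm, hbc.symm, mul_add,
    Finset.sum_add_distrib, hac, hbc, had, hbd, hcd] at ha hb hc
  omega

theorem coeff_eq_zero_of_groupCount [NeZero m] (hac : a ≠ c) (had : a ≠ d) (hbc : b ≠ c)
    (hbd : b ≠ d) (hcd : c ≠ d) (h : groupCount n c + groupCount n d = 2 * (m - 1)) :
    coeff n (diffProd dftForm Finset.univ c d * diffProd dftForm (Finset.univ.erase 0) a b) = 0 ∧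
    coeff n (markedProd dftForm c d 0 * diffProd dftForm (Finset.univ.erase 0) a b) = 0 := by
  let ω : Fin 4 → ℕ := Pi.single c 1 + Pi.single d 1
  have hωc : ω c = 1 := by simp [ω, hcd]
  have hωd : ω d = 1 := by simp [ω, hcd.symm]
  have hωa : ω a = 0 := by simp [ω, hac, had]
  have hωb : ω b = 0 := by simp [ω, hbc, hbd]
  have hm := NeZero.pos m
  have hw : Finsupp.weight (groupWeight ω) n = 2 * (m - 1) := by
    rw [weight_groupWeight, ← h]
    simp [ω, Pi.single_apply, mul_add, Finset.sum_add_distrib]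
  have hR := isWeightedHomogeneous_diffProd ω (Finset.univ.erase (0 : Fin m)) (a := a) (b := b)
    (by rw [hωa, hωb])
  constructor
  · refine ((isWeightedHomogeneous_diffProd ω Finset.univ (a := c) (b := d)
      (by rw [hωc, hωd])).mul hR).coeff_eq_zero n ?_
    rw [hw, Finset.card_univ, Fintype.card_fin, hωa, hωc]
    simp; omega
  · refine ((isWeightedHomogeneous_markedProd ω 0 (a := c) (b := d)
      (by rw [hωc, hωd])).mul hR).coeff_eq_zero n ?_
    rw [hw, hωa, hωc]
    simp; omega

end Support

/-- The number `k` of the result belonging to a pattern compatible with the inputs `φ⁺`, `φ⁻`. -/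
def phiResult (n : Fin (m * 4) → ℕ) : ℕ :=
  if ∑ q, n (mode q 0) + ∑ q, n (mode q 1) = 2 * m then (∑ q, n (mode q 1)) / 2
  else (∑ q, n (mode q 3)) / 2

variable [NeZero m] (hm : 0 < m)

/-- The part of the output state for `φ⁻` that leads to the result `k`, up to normalization. -/
noncomputable def phiSector (m : ℕ) [NeZero m] (k : ℕ) : MvPolynomial (Fin (m * 4)) ℂ :=
  diffComponent dftForm Finset.univ 0 1 k * diffProd dftForm (Finset.univ.erase 0) 2 3 -
    diffComponent dftForm Finset.univ 2 3 k * diffProd dftForm (Finset.univ.erase 0) 0 1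

theorem outState_phiMinus_eq_sum : outState hm phiMinus =
    ∑ k ∈ Finset.range (m + 1), C (outNorm m) * phiSector m k := by
  rw [outState_phiMinus, diffProd_eq_sum_diffComponent dftForm Finset.univ 0 1,
    diffProd_eq_sum_diffComponent dftForm Finset.univ 2 3, Finset.card_univ, Fintype.card_fin,
    Finset.sum_mul, Finset.sum_mul, ← Finset.sum_sub_distrib, Finset.mul_sum]
  rfl

theorem phiSector_cases {n : Fin (m * 4) →₀ ℕ} {k : ℕ} (h : coeff n (phiSector m k) ≠ 0) :
    (groupCount n 0 = 2 * (m - k) ∧ groupCount n 1 = 2 * k ∧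
      groupCount n 2 + groupCount n 3 = 2 * (m - 1)) ∨
    (groupCount n 2 = 2 * (m - k) ∧ groupCount n 3 = 2 * k ∧
      groupCount n 0 + groupCount n 1 = 2 * (m - 1)) := by
  rw [phiSector, coeff_sub] at h
  by_cases h1 : coeff n (diffComponent dftForm Finset.univ 0 1 k *
      diffProd dftForm (Finset.univ.erase 0) 2 3) = 0
  · rw [h1, zero_sub, neg_ne_zero] at h
    exact Or.inr (groupCount_of_coeff_diffComponent_ne_zero (by decide) (by decide) (by decide)
      (by decide) (by decide) (by decide) h)
  · exact Or.inl (groupCount_of_coeff_diffComponent_ne_zero (by decide) (by decide) (by decide)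
      (by decide) (by decide) (by decide) h1)

theorem phiResult_of_coeff_phiSector_ne_zero {n : Fin (m * 4) →₀ ℕ} {k : ℕ} (hk : k ≤ m)
    (h : coeff n (phiSector m k) ≠ 0) : ∑ i, n i = 4 * (m - 1) + 2 ∧ phiResult n = k := by
  have hpos := NeZero.pos m
  have hr : phiResult n = if groupCount n 0 + groupCount n 1 = 2 * m then groupCount n 1 / 2
    else groupCount n 3 / 2 := rfl
  rw [sum_eq_sum_groupCount, Fin.sum_univ_four, hr]
  rcases phiSector_cases h with h | h
  · rw [if_pos (by omega)]; omega
  · rw [if_neg (by omega)]; omega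

omit [NeZero m] in
theorem outNorm_conj_mul_self :
    (starRingEnd ℂ) (outNorm m) * outNorm m = 1 / 2 * (1 / 4) ^ (2 * m - 1) := by
  have h : (starRingEnd ℂ) (outNorm m) = outNorm m := by
    rw [outNorm, map_mul, map_inv₀, Complex.conj_ofReal, map_pow, map_div₀, map_one, map_ofNat]
  have h4 : (1 / 4 : ℂ) = 1 / 2 * (1 / 2) := by norm_num
  rw [h, outNorm, mul_mul_mul_comm, inv_sqrt_two_mul_self, ← mul_pow, h4]

theorem bombieri_phiSector (k : ℕ) :
    bombieri (C (outNorm m) * phiSector m k) (C (outNorm m) * phiSector m k) =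
      m.choose k / 2 ^ m := by
  set P := diffComponent dftForm Finset.univ 0 1 k *
    diffProd dftForm (Finset.univ.erase (0 : Fin m)) 2 3 with hP
  set Q := diffComponent dftForm Finset.univ 2 3 k *
    diffProd dftForm (Finset.univ.erase (0 : Fin m)) 0 1 with hQ
  have hPP : bombieri P P = (m.choose k * 2 ^ (m - 1)) * 2 ^ (m + (m - 1)) := by
    rw [hP, bombieri_diffComponent (by decide) (by decide) (by decide) (by decide) (by decide)
      (by decide), card_erase_univ, Finset.card_univ, Fintype.card_fin]
  have hQQ : bombieri Q Q = (m.choose k * 2 ^ (m - 1)) * 2 ^ (m + (m - 1)) := by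
    rw [hQ, bombieri_diffComponent (by decide) (by decide) (by decide) (by decide) (by decide)
      (by decide), card_erase_univ, Finset.card_univ, Fintype.card_fin]
  have hdis : ∀ n, coeff n P ≠ 0 → coeff n Q ≠ 0 → False := by
    intro n h1 h2
    have hpos := NeZero.pos m
    have h1 := groupCount_of_coeff_diffComponent_ne_zero (by decide) (by decide) (by decide)
      (by decide) (by decide) (by decide) h1
    have h2 := groupCount_of_coeff_diffComponent_ne_zero (by decide) (by decide) (by decide)
      (by decide) (by decide) (by decide) h2
    omega
  have hPQ : bombieri P Q = 0 := Finset.sum_eq_zero fun n hn => by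
    by_cases h : coeff n Q = 0
    · rw [h, mul_zero]
    · exact (hdis n (mem_support_iff.mp hn) h).elim
  have hQP : bombieri Q P = 0 := Finset.sum_eq_zero fun n hn => by
    by_cases h : coeff n P = 0
    · rw [h, mul_zero]
    · exact (hdis n h (mem_support_iff.mp hn)).elim
  have hsec : phiSector m k = P + C (-1) * Q := by
    rw [phiSector, ← hP, ← hQ]; simp [sub_eq_add_neg]
  rw [bombieri_C_mul_left, bombieri_C_mul_right, ← mul_assoc, outNorm_conj_mul_self, hsec]
  simp only [bombieri_add_left, bombieri_add_right, bombieri_C_mul_left, bombieri_C_mul_right,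
    hPP, hQQ, hPQ, hQP]
  obtain ⟨j, rfl⟩ := Nat.exists_eq_succ_of_ne_zero (NeZero.ne m)
  have e1 : 2 * j.succ - 1 = 2 * j + 1 := by omega
  have e2 : j.succ - 1 = j := rfl
  have h4 : (4 : ℂ) = 2 ^ 2 := by norm_num
  rw [e1, e2, h4, one_div_pow, ← pow_mul]
  simp only [map_neg, map_one, Nat.succ_eq_add_one]
  field_simp
  ring

theorem isWeightedHomogeneous_ancillaFactor {M : Type*} [AddCommMonoid M] (ω : Fin 4 → M)
    (h : 2 • ω 1 = 2 • ω 0) (h' : 2 • ω 3 = 2 • ω 2) :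
    IsWeightedHomogeneous (groupWeight ω)
      (ancillaFactor dftForm : MvPolynomial (Fin (m * 4)) ℂ)
      ((m - 1) • 2 • ω 0 + (m - 1) • 2 • ω 2) := by
  have := (isWeightedHomogeneous_diffProd ω (Finset.univ.erase (0 : Fin m)) h).mul
    (isWeightedHomogeneous_diffProd ω (Finset.univ.erase (0 : Fin m)) h')
  rwa [card_erase_univ] at this

theorem sum_of_coeff_outState_ne_zero (v : TwoQubit → ℂ) {n : Fin (m * 4) →₀ ℕ}
    (h : coeff n (outState hm v) ≠ 0) : ∑ i, n i = 4 * (m - 1) + 2 := by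
  have hL := fun p => isWeightedHomogeneous_dftForm (fun _ => (1 : ℕ)) (0 : Fin m) p
  have hb : ∀ b, IsWeightedHomogeneous (groupWeight fun _ => (1 : ℕ)) (outBasis hm b)
      (1 + 1 + ((m - 1) • 2 • 1 + (m - 1) • 2 • 1)) := by
    intro b
    rw [outBasis_eq]
    refine ((IsWeightedHomogeneous.mul ?_ ?_).mul
      (isWeightedHomogeneous_ancillaFactor _ rfl rfl)).C_mul _
    · split_ifs <;> exact (hL _).add (hL _)
    · split_ifs <;> exact (hL _).sub (hL _)
  have hv : IsWeightedHomogeneous (groupWeight fun _ => (1 : ℕ)) (outState hm v) _ :=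
    IsWeightedHomogeneous.sum _ _ _ fun b _ => (hb b).C_mul (v b)
  have h1 := hv h
  rw [weight_groupWeight] at h1
  rw [sum_eq_sum_groupCount]
  simp only [smul_eq_mul, mul_one] at h1
  omega

/-- The parity classes separating `ψ⁺`, `ψ⁻` and `φ^±`. -/
def parityWeight : Fin 4 → ZMod 2 × ZMod 2 := ![(1, 0), (0, 1), (1, 1), (0, 0)]

theorem two_nsmul_zmod_two_prod (x : ZMod 2 × ZMod 2) : 2 • x = 0 := by revert x; decide

omit [NeZero m] in
theorem isWeightedHomogeneous_parity_phi {p : Fin 4} {P : MvPolynomial (Fin (m * 4)) ℂ}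
    {s : Finset (Fin m)} {c d : Fin 4} {k : ℕ}
    (hP : IsWeightedHomogeneous (groupWeight parityWeight) P (k • 2 • parityWeight p)) :
    IsWeightedHomogeneous (groupWeight parityWeight) (P * diffProd dftForm s c d) 0 := by
  have h := hP.mul (isWeightedHomogeneous_diffProd parityWeight s (a := c) (b := d)
    (by simp only [two_nsmul_zmod_two_prod]))
  simpa only [two_nsmul_zmod_two_prod, smul_zero, add_zero] using h

theorem parity_outState_phiMinus :
    IsWeightedHomogeneous (groupWeight parityWeight) (outState hm phiMinus) 0 := by
  have h : ∀ x y, 2 • parityWeight x = 2 • parityWeight y := fun x y => by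
    simp only [two_nsmul_zmod_two_prod]
  rw [outState_phiMinus]
  exact ((isWeightedHomogeneous_parity_phi (isWeightedHomogeneous_diffProd _ _ (h _ _))).sub
    (isWeightedHomogeneous_parity_phi (isWeightedHomogeneous_diffProd _ _ (h _ _)))).C_mul _

theorem parity_outState_phiPlus :
    IsWeightedHomogeneous (groupWeight parityWeight) (outState hm phiPlus) 0 := by
  have h : ∀ x y, 2 • parityWeight x = 2 • parityWeight y := fun x y => by
    simp only [two_nsmul_zmod_two_prod]
  rw [outState_phiPlus]
  exact ((isWeightedHomogeneous_parity_phi (isWeightedHomogeneous_markedProd _ _ (h _ _))).sub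
    (isWeightedHomogeneous_parity_phi (isWeightedHomogeneous_markedProd _ _ (h _ _)))).C_mul _

theorem parity_ancillaFactor : IsWeightedHomogeneous (groupWeight parityWeight)
    (ancillaFactor dftForm : MvPolynomial (Fin (m * 4)) ℂ) 0 := by
  have h := isWeightedHomogeneous_ancillaFactor (m := m) parityWeight
    (by simp only [two_nsmul_zmod_two_prod]) (by simp only [two_nsmul_zmod_two_prod])
  simpa only [two_nsmul_zmod_two_prod, smul_zero, add_zero] using h

theorem parity_outState_psiPlus :
    IsWeightedHomogeneous (groupWeight parityWeight) (outState hm psiPlus) (1, 1) := by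
  have hL := fun p => isWeightedHomogeneous_dftForm parityWeight (0 : Fin m) p
  rw [outState_psiPlus]
  exact ((((hL 0).mul (hL 1)).sub ((hL 2).mul (hL 3))).mul parity_ancillaFactor).C_mul _

theorem parity_outState_psiMinus :
    IsWeightedHomogeneous (groupWeight parityWeight) (outState hm psiMinus) (1, 0) := by
  have hL := fun p => isWeightedHomogeneous_dftForm parityWeight (0 : Fin m) p
  rw [outState_psiMinus]
  exact ((((hL 1).mul (hL 2)).sub ((hL 0).mul (hL 3))).mul parity_ancillaFactor).C_mul _

/-- On patterns that `φ⁻` can produce, the amplitude of `φ⁺` is determined by the result `k`. -/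
theorem coeff_outState_phiPlus {n : Fin (m * 4) →₀ ℕ} (h : coeff n (outState hm phiMinus) ≠ 0) :
    phiResult n ≤ m ∧ coeff n (outState hm phiPlus) =
      ((m : ℂ) - 2 * (phiResult n : ℂ)) / m * coeff n (outState hm phiMinus) := by
  have hpos := NeZero.pos m
  have hm0 : (m : ℂ) ≠ 0 := Nat.cast_ne_zero.mpr (NeZero.ne m)
  have hsec : ∃ k ∈ Finset.range (m + 1), coeff n (phiSector m k) ≠ 0 := by
    by_contra! hcon
    refine h ?_
    rw [outState_phiMinus_eq_sum, coeff_sum]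
    exact Finset.sum_eq_zero fun k hk => by rw [coeff_C_mul, hcon k hk, mul_zero]
  obtain ⟨k, hk, hne⟩ := hsec
  have hk' : k ≤ m := Nat.lt_succ_iff.mp (Finset.mem_range.mp hk)
  obtain ⟨-, hr⟩ := phiResult_of_coeff_phiSector_ne_zero hk' hne
  rw [hr]
  refine ⟨hk', ?_⟩
  rw [outState_phiMinus, coeff_C_mul, coeff_sub] at h ⊢
  rw [outState_phiPlus, coeff_C_mul, coeff_sub]
  have hcast : ((m - k : ℕ) : ℂ) = m - k := Nat.cast_sub hk'
  rcases phiSector_cases hne with ⟨h1, h2, h3⟩ | ⟨h1, h2, h3⟩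
  · obtain ⟨z1, z2⟩ := coeff_eq_zero_of_groupCount (a := 0) (b := 1) (by decide) (by decide)
      (by decide) (by decide) (by decide) h3
    rw [z1, sub_zero] at h
    have key := coeff_markedProd (by decide) (by decide) (by decide) (by decide) (by decide) n _
      (right_ne_zero_of_mul h)
    rw [z1, z2, sub_zero, sub_zero]
    rw [h1, h2] at key
    push_cast at key
    rw [hcast] at key
    rw [div_mul_eq_mul_div, eq_div_iff hm0]
    linear_combination (outNorm m) * key
  · obtain ⟨z1, z2⟩ := coeff_eq_zero_of_groupCount (a := 2) (b := 3) (by decide) (by decide)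
      (by decide) (by decide) (by decide) h3
    rw [z1, zero_sub] at h
    have key := coeff_markedProd (by decide) (by decide) (by decide) (by decide) (by decide) n _
      (neg_ne_zero.mp (right_ne_zero_of_mul h))
    rw [z1, z2, zero_sub, zero_sub]
    rw [h1, h2] at key
    push_cast at key
    rw [hcast] at key
    rw [div_mul_eq_mul_div, eq_div_iff hm0]
    linear_combination -(outNorm m) * key

theorem sum_norm_sq_amp_phiSector {k : ℕ} (hk : k ≤ m) :
    ∑ n ∈ patterns m with phiResult n = k, ‖amp (outState hm phiMinus) n‖ ^ 2 =
      m.choose k / 2 ^ m := by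
  have h := sum_norm_sq_amp (N := 4 * (m - 1) + 2) (outState hm phiMinus)
    (C (outNorm m) * phiSector m k) (fun n => phiResult n = k) ?_ ?_
  · rw [bombieri_phiSector] at h
    exact Complex.ofReal_injective (h.trans (by push_cast; rfl))
  · intro n hn
    rw [coeff_C_mul] at hn
    exact phiResult_of_coeff_phiSector_ne_zero hk (right_ne_zero_of_mul hn)
  · intro n hn
    rw [outState_phiMinus_eq_sum, coeff_sum, Finset.sum_eq_single k]
    · intro j hj hjk
      by_contra hne
      rw [coeff_C_mul] at hne
      exact hjk ((phiResult_of_coeff_phiSector_ne_zero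
        (Nat.lt_succ_iff.mp (Finset.mem_range.mp hj)) (right_ne_zero_of_mul hne)).2.symm.trans hn)
    · exact fun h => absurd (Finset.mem_range.mpr (Nat.lt_succ_iff.mpr hk)) h

theorem sum_norm_sq_amp_outState (v : TwoQubit → ℂ) :
    ((∑ n ∈ patterns m, ‖amp (outState hm v) n‖ ^ 2 : ℝ) : ℂ) =
      ∑ b, (starRingEnd ℂ) (v b) * v b := by
  have h := sum_norm_sq_amp (N := 4 * (m - 1) + 2) (outState hm v) (outState hm v) (fun _ => True)
    (fun n hn => ⟨sum_of_coeff_outState_ne_zero hm v hn, trivial⟩) (fun _ _ => rfl)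
  rw [Finset.filter_true, bombieri_outState] at h
  exact h

end LinearOptics

namespace LinearOptics

open MvPolynomial

section Binomial

theorem sum_fin_choose_div (m : ℕ) :
    ∑ k : Fin (m + 1), (m.choose k : ℝ) / 2 ^ m = 1 := by
  rw [Fin.sum_univ_eq_sum_range (fun k => (m.choose k : ℝ) / 2 ^ m), ← Finset.sum_div,
    div_eq_one_iff_eq (by positivity)]
  exact_mod_cast Nat.sum_range_choose m

theorem bernsteinPolynomial_eval_half {m k : ℕ} (hk : k ≤ m) :
    (bernsteinPolynomial ℝ m k).eval (1 / 2) = (m.choose k : ℝ) / 2 ^ m := by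
  have h : (1 - 1 / 2 : ℝ) = 1 / 2 := by norm_num
  simp only [bernsteinPolynomial, Polynomial.eval_mul, Polynomial.eval_pow, Polynomial.eval_sub,
    Polynomial.eval_natCast, Polynomial.eval_X, Polynomial.eval_one]
  rw [h, mul_assoc, ← pow_add, Nat.add_sub_cancel' hk, one_div_pow, mul_one_div]

theorem sum_fin_choose_div_mul {m : ℕ} (hm : 0 < m) :
    ∑ k : Fin (m + 1), (m.choose k : ℝ) / 2 ^ m * (((m : ℝ) - 2 * (k : ℕ)) / m) = 0 := by
  have hm0 : (m : ℝ) ≠ 0 := Nat.cast_ne_zero.mpr hm.ne'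
  have h := congrArg (Polynomial.eval (1 / 2 : ℝ)) (bernsteinPolynomial.sum_smul ℝ m)
  rw [Polynomial.eval_finsetSum, ← Fin.sum_univ_eq_sum_range
    (fun k => Polynomial.eval (1 / 2 : ℝ) (k • bernsteinPolynomial ℝ m k))] at h
  simp only [nsmul_eq_mul, Polynomial.eval_X, Polynomial.eval_mul, Polynomial.eval_natCast] at h
  have h' : ∀ k : Fin (m + 1), (m.choose k : ℝ) / 2 ^ m * (((m : ℝ) - 2 * (k : ℕ)) / m) =
      (m.choose k : ℝ) / 2 ^ m -
        2 / m * ((k : ℕ) * (bernsteinPolynomial ℝ m k).eval (1 / 2)) := by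
    intro k
    rw [bernsteinPolynomial_eval_half (Nat.lt_succ_iff.mp k.2)]
    field_simp
  rw [Finset.sum_congr rfl fun k _ => h' k, Finset.sum_sub_distrib, ← Finset.mul_sum, h,
    sum_fin_choose_div]
  field_simp
  norm_num

theorem sum_fin_choose_div_mul_sq {m : ℕ} (hm : 0 < m) :
    ∑ k : Fin (m + 1), (m.choose k : ℝ) / 2 ^ m * (((m : ℝ) - 2 * (k : ℕ)) / m) ^ 2 =
      (m : ℝ)⁻¹ := by
  have hm0 : (m : ℝ) ≠ 0 := Nat.cast_ne_zero.mpr hm.ne'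
  have h := congrArg (Polynomial.eval (1 / 2 : ℝ)) (bernsteinPolynomial.variance ℝ m)
  rw [Polynomial.eval_finsetSum, ← Fin.sum_univ_eq_sum_range (fun k => Polynomial.eval (1 / 2 : ℝ)
    ((m • Polynomial.X - (k : Polynomial ℝ)) ^ 2 * bernsteinPolynomial ℝ m k))] at h
  simp only [nsmul_eq_mul, Polynomial.eval_X, Polynomial.eval_mul, Polynomial.eval_sub,
    Polynomial.eval_pow, Polynomial.eval_one, Polynomial.eval_natCast] at h
  have h' : ∀ k : Fin (m + 1), (m.choose k : ℝ) / 2 ^ m * (((m : ℝ) - 2 * (k : ℕ)) / m) ^ 2 =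
      4 / m ^ 2 * ((m * (1 / 2) - (k : ℕ)) ^ 2 * (bernsteinPolynomial ℝ m k).eval (1 / 2)) := by
    intro k
    rw [bernsteinPolynomial_eval_half (Nat.lt_succ_iff.mp k.2)]
    field_simp
    ring
  rw [Finset.sum_congr rfl fun k _ => h' k, ← Finset.mul_sum, h]
  field_simp
  norm_num

end Binomial

/-- The scalar in front of `K_k`. -/
noncomputable def krausScalar (m k : ℕ) : ℝ := Real.sqrt (m.choose k) * (2 : ℝ) ^ (-(m : ℝ) / 2)

theorem krausScalar_sq (m k : ℕ) : krausScalar m k ^ 2 = (m.choose k : ℝ) / 2 ^ m := by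
  rw [krausScalar, mul_pow, Real.sq_sqrt (Nat.cast_nonneg _), ← Real.rpow_natCast,
    ← Real.rpow_mul (by norm_num), Nat.cast_ofNat, div_mul_cancel₀ _ (by norm_num),
    Real.rpow_neg (by norm_num), Real.rpow_natCast, ← div_eq_mul_inv]

theorem krausK_eq (m k : ℕ) : krausK m k = (krausScalar m k : ℂ) •
    (bra phiMinus + ((((m : ℝ) - 2 * (k : ℝ)) / m : ℝ) : ℂ) • bra phiPlus) := by
  rw [krausK, krausScalar]; push_cast; rfl

theorem bra_basis_sum (x : TwoQubit → ℂ) :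
    Matrix.of (fun (_ : Unit) b => x b) =
      (∑ b, psiPlus b * x b) • bra psiPlus + (∑ b, psiMinus b * x b) • bra psiMinus +
      (∑ b, phiPlus b * x b) • bra phiPlus + (∑ b, phiMinus b * x b) • bra phiMinus := by
  ext u ⟨b1, b2⟩
  have h := inv_sqrt_two_mul_self
  fin_cases b1 <;> fin_cases b2 <;>
    simp [Fintype.sum_prod_type, bra, psiPlus, psiMinus, phiPlus, phiMinus, ket, Pi.single_apply] <;>
    linear_combination -2 * x _ * h

theorem isMeasurement_bellKraus {m : ℕ} (hm : 0 < m) : IsMeasurement (bellKraus m) := by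
  have hm1 : (0 : ℝ) ≤ 1 - (m : ℝ)⁻¹ := by
    have : (m : ℝ)⁻¹ ≤ 1 := inv_le_one_of_one_le₀ (by exact_mod_cast hm)
    linarith
  have hK : ∀ k : ℕ, (krausK m k)ᴴ * krausK m k =
      (((m.choose k : ℝ) / 2 ^ m : ℝ) : ℂ) • ((bra phiMinus)ᴴ * bra phiMinus) +
      (((m.choose k : ℝ) / 2 ^ m * (((m : ℝ) - 2 * (k : ℝ)) / m) : ℝ) : ℂ) •
        ((bra phiMinus)ᴴ * bra phiPlus + (bra phiPlus)ᴴ * bra phiMinus) +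
      (((m.choose k : ℝ) / 2 ^ m * (((m : ℝ) - 2 * (k : ℝ)) / m) ^ 2 : ℝ) : ℂ) •
        ((bra phiPlus)ᴴ * bra phiPlus) := by
    intro k
    rw [krausK_eq, ← krausScalar_sq]
    generalize ((m : ℝ) - 2 * (k : ℝ)) / m = r
    simp only [Matrix.conjTranspose_smul, Matrix.conjTranspose_add, Matrix.smul_mul,
      Matrix.mul_smul, Matrix.add_mul, Matrix.mul_add, Complex.star_def, Complex.conj_ofReal,
      smul_add, smul_smul, map_mul]
    push_cast
    module
  have h0 := congrArg (Complex.ofReal) (sum_fin_choose_div m)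
  have h1 := congrArg (Complex.ofReal) (sum_fin_choose_div_mul hm)
  have h2 := congrArg (Complex.ofReal) (sum_fin_choose_div_mul_sq hm)
  rw [Complex.ofReal_sum] at h0 h1 h2
  have hs : ((Real.sqrt (1 - (m : ℝ)⁻¹) : ℝ) : ℂ) * ((Real.sqrt (1 - (m : ℝ)⁻¹) : ℝ) : ℂ) =
      1 - ((m : ℝ)⁻¹ : ℝ) := by
    rw [← Complex.ofReal_mul, Real.mul_self_sqrt hm1]; push_cast; rfl
  rw [IsMeasurement, Fintype.sum_sum_type]
  simp only [bellKraus, Sum.elim_inl, Sum.elim_inr, Fin.sum_univ_three, hK,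
    Finset.sum_add_distrib, ← Finset.sum_smul, h0, h1, h2]
  simp only [Matrix.cons_val_zero, Matrix.cons_val_one, Matrix.cons_val, Matrix.conjTranspose_smul,
    Matrix.smul_mul, Matrix.mul_smul, smul_smul, Complex.star_def, Complex.conj_ofReal, hs]
  have h := inv_sqrt_two_mul_self
  have hb : (bra psiPlus)ᴴ * bra psiPlus + (bra psiMinus)ᴴ * bra psiMinus +
      (bra phiPlus)ᴴ * bra phiPlus + (bra phiMinus)ᴴ * bra phiMinus = 1 := by
    ext ⟨a1, a2⟩ ⟨b1, b2⟩
    fin_cases a1 <;> fin_cases a2 <;> fin_cases b1 <;> fin_cases b2 <;>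
      simp [Matrix.mul_apply, bra, psiPlus, psiMinus, phiPlus, phiMinus, ket,
        -mul_inv_rev] <;>
      linear_combination 2 * h
  rw [← hb, Complex.ofReal_zero, Complex.ofReal_one]
  module

/-- An apparatus realizes a measurement if its Kraus operators are multiples of those of their
results and the squared multipliers sum up to one for each result. -/
theorem realizes_of_multiplier {Ω ι o q : Type*} [DecidableEq ι] [Fintype o] [Fintype q]
    {S : Finset Ω} {A : Ω → Matrix o q ℂ} {K : ι → Matrix o q ℂ} (f : Ω → ι) (c : Ω → ℂ)
    (hA : ∀ n ∈ S, A n = c n • K (f n))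
    (hc : ∀ l, ∑ n ∈ S with f n = l, ‖c n‖ ^ 2 = 1 ∨ K l = 0) : Realizes S A K := by
  refine ⟨f, fun n hn => ⟨c n, hA n hn⟩, fun l ρ => ?_⟩
  have h : ∀ n ∈ S.filter (fun n => f n = l), A n * ρ * (A n)ᴴ =
      ((‖c n‖ ^ 2 : ℝ) : ℂ) • (K l * ρ * (K l)ᴴ) := by
    intro n hn
    obtain ⟨hn, hl⟩ := Finset.mem_filter.mp hn
    rw [hA n hn, hl, Matrix.conjTranspose_smul, Matrix.smul_mul, Matrix.smul_mul, Matrix.mul_smul,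
      smul_smul, Complex.star_def, Complex.mul_conj']
    push_cast
    rfl
  rw [Finset.sum_congr rfl h, ← Finset.sum_smul, ← Complex.ofReal_sum]
  rcases hc l with h | h
  · rw [h, Complex.ofReal_one, one_smul]
  · rw [h]; simp

theorem realizes_bellKraus {Ω : Type*} {m : ℕ} (hm : 0 < m) {S : Finset Ω}
    {A : Ω → Matrix Unit TwoQubit ℂ} (x₁ x₂ x₃ x₄ : Ω → ℂ) (κ : Ω → ℕ)
    (hA : ∀ n, A n =
      x₁ n • bra psiPlus + x₂ n • bra psiMinus + x₃ n • bra phiPlus + x₄ n • bra phiMinus)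
    (h₁ : ∀ n, x₁ n ≠ 0 → x₂ n = 0 ∧ x₃ n = 0 ∧ x₄ n = 0)
    (h₂ : ∀ n, x₂ n ≠ 0 → x₁ n = 0 ∧ x₃ n = 0 ∧ x₄ n = 0)
    (h₄ : ∀ n, x₄ n ≠ 0 → κ n ≤ m ∧
      x₃ n = ((((m : ℝ) - 2 * (κ n : ℝ)) / m : ℝ) : ℂ) * x₄ n)
    (s₁ : ∑ n ∈ S, ‖x₁ n‖ ^ 2 = 1) (s₂ : ∑ n ∈ S, ‖x₂ n‖ ^ 2 = 1)
    (s₃ : ∑ n ∈ S, ‖x₃ n‖ ^ 2 = 1)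
    (s₄ : ∀ k ≤ m, ∑ n ∈ S with κ n = k, ‖x₄ n‖ ^ 2 = (m.choose k : ℝ) / 2 ^ m) :
    Realizes S A (bellKraus m) := by
  classical
  let f : Ω → Fin 3 ⊕ Fin (m + 1) := fun n =>
    if x₁ n ≠ 0 then Sum.inl 0 else if x₂ n ≠ 0 then Sum.inl 1
    else if x₄ n ≠ 0 then Sum.inr (Fin.ofNat (m + 1) (κ n)) else Sum.inl 2
  let r : ℝ := Real.sqrt (1 - (m : ℝ)⁻¹)
  let c : Ω → ℂ := fun n =>
    if x₁ n ≠ 0 then x₁ n else if x₂ n ≠ 0 then x₂ n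
    else if x₄ n ≠ 0 then x₄ n / krausScalar m (κ n) else x₃ n / r
  have hm1 : (0 : ℝ) ≤ 1 - (m : ℝ)⁻¹ := by
    have : (m : ℝ)⁻¹ ≤ 1 := inv_le_one_of_one_le₀ (by exact_mod_cast hm)
    linarith
  have hr2 : r ^ 2 = 1 - (m : ℝ)⁻¹ := Real.sq_sqrt hm1
  have f0 : ∀ n, f n = Sum.inl 0 ↔ x₁ n ≠ 0 := fun n => by
    simp only [f]; split_ifs <;> simp_all
  have f1 : ∀ n, f n = Sum.inl 1 ↔ x₂ n ≠ 0 := fun n => by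
    have := h₁ n
    simp only [f]; split_ifs <;> simp_all
  have f2 : ∀ n, f n = Sum.inl 2 ↔ x₁ n = 0 ∧ x₂ n = 0 ∧ x₄ n = 0 := fun n => by
    simp only [f]; split_ifs <;> simp_all
  have fk : ∀ n (k : Fin (m + 1)), f n = Sum.inr k ↔ x₄ n ≠ 0 ∧ κ n = k := fun n k => by
    have h1 := h₁ n
    have h2 := h₂ n
    have h4 := fun h => (h₄ n h).1
    simp only [f]
    split_ifs with g1 g2 g3
    · simp_all
    · simp_all
    · have : κ n % (m + 1) = κ n := Nat.mod_eq_of_lt (Nat.lt_succ_of_le (h4 g3))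
      simp [g3, Fin.ext_iff, this]
    · simp_all
  have hscal : ∀ k ≤ m, (0 : ℝ) < (m.choose k : ℝ) / 2 ^ m := fun k hk => by
    have := Nat.choose_pos hk
    positivity
  have hscal0 : ∀ k ≤ m, krausScalar m k ≠ 0 := fun k hk h => by
    have := hscal k hk
    rw [← krausScalar_sq, h] at this
    simp at this
  have filter_sum : ∀ (p : Ω → Prop) [DecidablePred p] (x : Ω → ℂ), (∀ n, x n ≠ 0 → p n) →
      ∑ n ∈ S with p n, ‖x n‖ ^ 2 = ∑ n ∈ S, ‖x n‖ ^ 2 := by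
    intro p _ x h
    refine Finset.sum_filter_of_ne fun n _ hn => h n fun h0 => hn ?_
    rw [h0, norm_zero, zero_pow two_ne_zero]
  have sk : ∀ k : Fin (m + 1), ∑ n ∈ S with f n = Sum.inr k, ‖x₄ n‖ ^ 2 =
      (m.choose k : ℝ) / 2 ^ m := by
    intro k
    rw [← s₄ k (Nat.lt_succ_iff.mp k.2)]
    simp only [fk]
    rw [← Finset.filter_filter, Finset.filter_comm]
    refine Finset.sum_filter_of_ne fun n _ hn h0 => hn ?_
    rw [h0, norm_zero, zero_pow two_ne_zero]
  have s3 : ∑ n ∈ S with f n = Sum.inl 2, ‖x₃ n‖ ^ 2 = 1 - (m : ℝ)⁻¹ := by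
    rw [← Finset.sum_fiberwise S f, Fintype.sum_sum_type, Fin.sum_univ_three] at s₃
    have e0 : ∑ n ∈ S with f n = Sum.inl 0, ‖x₃ n‖ ^ 2 = 0 := by
      refine Finset.sum_eq_zero fun n hn => ?_
      rw [(h₁ n ((f0 n).mp (Finset.mem_filter.mp hn).2)).2.1, norm_zero, zero_pow two_ne_zero]
    have e1 : ∑ n ∈ S with f n = Sum.inl 1, ‖x₃ n‖ ^ 2 = 0 := by
      refine Finset.sum_eq_zero fun n hn => ?_
      rw [(h₂ n ((f1 n).mp (Finset.mem_filter.mp hn).2)).2.1, norm_zero, zero_pow two_ne_zero]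
    have ek : ∀ k : Fin (m + 1), ∑ n ∈ S with f n = Sum.inr k, ‖x₃ n‖ ^ 2 =
        (m.choose k : ℝ) / 2 ^ m * (((m : ℝ) - 2 * (k : ℕ)) / m) ^ 2 := by
      intro k
      rw [← sk k, Finset.sum_mul]
      refine Finset.sum_congr rfl fun n hn => ?_
      obtain ⟨h4, hk⟩ := (fk n k).mp (Finset.mem_filter.mp hn).2
      rw [(h₄ n h4).2, norm_mul, mul_pow, hk, Complex.norm_real, Real.norm_eq_abs, sq_abs, mul_comm]
    rw [e0, e1, Finset.sum_congr rfl fun k _ => ek k, sum_fin_choose_div_mul_sq hm] at s₃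
    linarith
  have hx3 : r = 0 → ∀ n ∈ S, f n = Sum.inl 2 → x₃ n = 0 := by
    intro hr n hn hf
    rw [← hr2, hr, zero_pow two_ne_zero, Finset.sum_eq_zero_iff_of_nonneg fun _ _ => sq_nonneg _]
      at s3
    simpa using s3 n (Finset.mem_filter.mpr ⟨hn, hf⟩)
  refine realizes_of_multiplier f c ?_ ?_
  · intro n hn
    rw [hA]
    by_cases g1 : x₁ n ≠ 0
    · obtain ⟨e1, e2, e3⟩ := h₁ n g1
      simp [(f0 n).mpr g1, c, g1, e1, e2, e3, bellKraus]
    by_cases g2 : x₂ n ≠ 0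
    · obtain ⟨e1, e2, e3⟩ := h₂ n g2
      simp [(f1 n).mpr g2, c, g2, e1, e2, e3, bellKraus]
    rw [not_not] at g1 g2
    by_cases g4 : x₄ n ≠ 0
    · obtain ⟨e1, e2⟩ := h₄ n g4
      have hK0 : (krausScalar m (κ n) : ℂ) ≠ 0 := by exact_mod_cast hscal0 _ e1
      have hf : f n = Sum.inr ⟨κ n, Nat.lt_succ_of_le e1⟩ := (fk n _).mpr ⟨g4, rfl⟩
      have hcn : c n = x₄ n / krausScalar m (κ n) := by simp [c, g1, g2, g4]
      rw [hf, hcn, bellKraus, Sum.elim_inr, krausK_eq, smul_smul, div_mul_cancel₀ _ hK0, g1, g2, e2]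
      module
    rw [not_not] at g4
    have hf : f n = Sum.inl 2 := (f2 n).mpr ⟨g1, g2, g4⟩
    have hcn : c n = x₃ n / r := by simp [c, g1, g2, g4]
    have hKl : bellKraus m (Sum.inl 2) = (r : ℂ) • bra phiPlus := rfl
    rw [hf, hcn, hKl, g1, g2, g4, smul_smul]
    by_cases hr : r = 0
    · simp [hx3 hr n hn hf]
    · rw [div_mul_cancel₀ _ (by exact_mod_cast hr)]
      simp
  · rintro (l | k)
    · fin_cases l
      · left
        rw [← s₁, ← filter_sum _ x₁ fun n => (f0 n).mpr]
        refine Finset.sum_congr rfl fun n hn => ?_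
        have g := (f0 n).mp (Finset.mem_filter.mp hn).2
        simp [c, g]
      · left
        rw [← s₂, ← filter_sum _ x₂ fun n => (f1 n).mpr]
        refine Finset.sum_congr rfl fun n hn => ?_
        have g := (f1 n).mp (Finset.mem_filter.mp hn).2
        simp [c, g, (h₂ n g).1]
      · by_cases hr : r = 0
        · right
          change (r : ℂ) • bra phiPlus = 0
          rw [hr, Complex.ofReal_zero, zero_smul]
        · left
          have hc : ∀ n ∈ S.filter (fun n => f n = Sum.inl 2), ‖c n‖ ^ 2 =
              ‖x₃ n‖ ^ 2 / r ^ 2 := by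
            intro n hn
            obtain ⟨g1, g2, g4⟩ := (f2 n).mp (Finset.mem_filter.mp hn).2
            simp [c, g1, g2, g4, div_pow]
          refine (Finset.sum_congr rfl hc).trans ?_
          rw [← Finset.sum_div, s3, hr2, div_self]
          rw [← hr2]
          exact pow_ne_zero _ hr
    · left
      have hk := Nat.lt_succ_iff.mp k.2
      have hc : ∀ n ∈ S.filter (fun n => f n = Sum.inr k), ‖c n‖ ^ 2 =
          ‖x₄ n‖ ^ 2 / ((m.choose k : ℝ) / 2 ^ m) := by
        intro n hn
        obtain ⟨g4, hκ⟩ := (fk n k).mp (Finset.mem_filter.mp hn).2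
        have g1 : x₁ n = 0 := by_contra fun h => g4 (h₁ n h).2.2
        have g2 : x₂ n = 0 := by_contra fun h => g4 (h₂ n h).2.2
        have hcn : c n = x₄ n / krausScalar m (κ n) := by simp [c, g1, g2, g4]
        rw [hcn, norm_div, div_pow, Complex.norm_real, Real.norm_eq_abs, sq_abs, krausScalar_sq, hκ]
      rw [Finset.sum_congr rfl hc, ← Finset.sum_div, sk, div_self (hscal k hk).ne']

theorem realizes_detectorKraus {m : ℕ} (hm : 0 < m) :
    Realizes (patterns m) (detectorKraus m hm) (bellKraus m) := by
  have : NeZero m := ⟨hm.ne'⟩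
  have amp_ne : ∀ {P : MvPolynomial (Fin (m * 4)) ℂ} {n : Fin (m * 4) → ℕ}, amp P n ≠ 0 →
      coeff (Finsupp.equivFunOnFinite.symm n) P ≠ 0 := fun h => right_ne_zero_of_mul h
  have excl : ∀ {P Q : MvPolynomial (Fin (m * 4)) ℂ} {d e : ZMod 2 × ZMod 2},
      IsWeightedHomogeneous (groupWeight parityWeight) P d →
      IsWeightedHomogeneous (groupWeight parityWeight) Q e → d ≠ e →
      ∀ n, amp P n ≠ 0 → amp Q n = 0 := by
    intro P Q d e hP hQ hde n hn
    rw [amp, hQ.coeff_eq_zero _ fun h => hde ((hP (amp_ne hn)).symm.trans h), mul_zero]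
  have total : ∀ v : TwoQubit → ℂ, ∑ b, (starRingEnd ℂ) (v b) * v b = 1 →
      ∑ n ∈ patterns m, ‖amp (outState hm v) n‖ ^ 2 = 1 := by
    intro v hv
    have h := sum_norm_sq_amp_outState hm v
    rw [hv] at h
    exact_mod_cast h
  have h2 := inv_sqrt_two_mul_self
  refine realizes_bellKraus hm (amp (outState hm psiPlus)) (amp (outState hm psiMinus))
    (amp (outState hm phiPlus)) (amp (outState hm phiMinus)) phiResult ?_ ?_ ?_ ?_ ?_ ?_ ?_ ?_
  · intro n
    have h := bra_basis_sum fun b => amp (outBasis hm b) n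
    simp only [← amp_outState] at h
    rw [← h]
    ext u b
    exact detectorKraus_apply hm n u b
  · intro n hn
    exact ⟨excl (parity_outState_psiPlus hm) (parity_outState_psiMinus hm) (by decide) n hn,
      excl (parity_outState_psiPlus hm) (parity_outState_phiPlus hm) (by decide) n hn,
      excl (parity_outState_psiPlus hm) (parity_outState_phiMinus hm) (by decide) n hn⟩
  · intro n hn
    exact ⟨excl (parity_outState_psiMinus hm) (parity_outState_psiPlus hm) (by decide) n hn,
      excl (parity_outState_psiMinus hm) (parity_outState_phiPlus hm) (by decide) n hn,
      excl (parity_outState_psiMinus hm) (parity_outState_phiMinus hm) (by decide) n hn⟩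
  · intro n hn
    obtain ⟨h1, h2⟩ := coeff_outState_phiPlus hm (amp_ne hn)
    refine ⟨h1, ?_⟩
    rw [amp, h2, amp]
    push_cast
    exact mul_left_comm _ _ _
  · refine total _ ?_
    simp [Fintype.sum_prod_type, psiPlus, ket, Pi.single_apply, -mul_inv_rev]
    linear_combination 2 * h2
  · refine total _ ?_
    simp [Fintype.sum_prod_type, psiMinus, ket, Pi.single_apply, -mul_inv_rev]
    linear_combination 2 * h2
  · refine total _ ?_
    simp [Fintype.sum_prod_type, phiPlus, ket, Pi.single_apply, -mul_inv_rev]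
    linear_combination 2 * h2
  · exact fun k hk => sum_norm_sq_amp_phiSector hm hk

end LinearOptics

theorem theorem2 (m : ℕ) (hm : 0 < m) :
    LinearOptics.bellTransfer m hm ∈ Matrix.unitaryGroup (Fin (m * 4)) ℂ ∧
    LinearOptics.IsMeasurement (LinearOptics.bellKraus m) ∧
    LinearOptics.Realizes (LinearOptics.patterns m) (LinearOptics.detectorKraus m hm)
      (LinearOptics.bellKraus m) :=
  ⟨LinearOptics.bellTransfer_mem_unitaryGroup m hm, LinearOptics.isMeasurement_bellKraus hm,
    LinearOptics.realizes_detectorKraus hm⟩
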